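/- \textbf{Theorem (Hausmann-Type Theorem for Metric Graphs).} Let $(\mathcal G,d_{\mathcal G})$ be a compact metric graph with finitely many vertices and edges (each edge being a segment of positive finite length; loops and multiple edges are allowed), where $d_{\mathcal G}$ is the length metric, i.e. $d_{\mathcal G}(a,b)$ is the infimum of the lengths of the paths joining $a$ and $b$ (and $\infty$ if $a$ and $b$ lie in different components). Let $\ell(\mathcal G)$ be the length of the smallest simple cycle of $\mathcal G$, with $\ell(\mathcal G)=\infty$ if $\mathcal G$ has no simple cycle. For $\beta>0$ let $\mathcal R^L_\beta(\mathcal G)$ be the Vietoris--Rips complex, whose simplices are the non-empty finite subsets of $\mathcal G$ of $d_{\mathcal G}$-diameter less than $\beta$, and let $\check{\mathcal C}^L_\beta(\mathcal G)$ be the \v{C}ech complex, whose simplices are the non-empty finite subsets of $\mathcal G$ such that the open $d_{\mathcal G}$-balls of radius $\beta$ about their points have a common point. The geometric realization $|\mathcal K|$ of a simplicial complex carries the coherent (weak) topology. (1) If $0<\beta<\ell(\mathcal G)/3$, then $\mathcal R^L_\beta(\mathcal G)=\check{\mathcal C}^L_{\beta/2}(\mathcal G)$, and $|\mathcal R^L_\beta(\mathcal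 G)|$ is homotopy equivalent to $\mathcal G$. (2) If $0<\beta\le\beta'<\ell(\mathcal G)/3$, then the natural inclusion $|\mathcal R^L_\beta(\mathcal G)|\hookrightarrow|\mathcal R^L_{\beta'}(\mathcal G)|$ is a homotopy equivalence. -/

import Mathlib

open Set
open scoped ENNReal

noncomputable section

namespace MetricGraph

/-! ### Length, length metric, metric graphs, systole -/

/-- The length of a continuous path: the supremum of the lengths of inscribed polygons. -/
def pathLength {G : Type*} [EMetricSpace G] {x y : G} (γ : Path x y) : ℝ≥0∞ :=
  eVariationOn γ (univ : Set unitInterval)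

/-- The distance is the length metric: `d(x, y)` is the infimum of the lengths of the paths
joining `x` and `y` (so `d(x, y) = ∞` exactly when no path of finite length joins them). -/
def IsLengthMetric (G : Type*) [EMetricSpace G] : Prop :=
  ∀ x y : G, edist x y = ⨅ γ : Path x y, pathLength γ

/-- A decomposition of `G` into finitely many vertices and finitely many edges.
The edge `e` is a segment `[0, len e]` mapped into `G` by arc length (a unit speed map is in
particular 1-Lipschitz, hence continuous), its two ends going to vertices; the open edges are
embedded, avoid the vertices and each other, and together with the vertices they cover `G`.
Loops and multiple edges are allowed. -/
structure GraphDecomposition (G : Type*) [EMetricSpace G] where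
  /-- the set of vertices -/
  vertices : Set G
  finite_vertices : vertices.Finite
  /-- the number of edges -/
  numEdges : ℕ
  /-- the lengths of the edges -/
  len : Fin numEdges → ℝ
  len_pos : ∀ e, 0 < len e
  /-- the arc length parametrizations of the edges -/
  edge : Fin numEdges → ℝ → G
  unitSpeed : ∀ e, HasUnitSpeedOn (edge e) (Icc 0 (len e))
  source_mem : ∀ e, edge e 0 ∈ vertices
  target_mem : ∀ e, edge e (len e) ∈ vertices
  injOn : ∀ e, InjOn (edge e) (Ioo 0 (len e))
  disjoint_vertices : ∀ e, Disjoint (edge e '' Ioo 0 (len e)) vertices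
  disjoint_edges : ∀ e e', e ≠ e' →
    Disjoint (edge e '' Ioo 0 (len e)) (edge e' '' Ioo 0 (len e'))
  cover : vertices ∪ ⋃ e, edge e '' Ioo 0 (len e) = univ

/-- A metric graph with finitely many edges, with its length metric. -/
def IsMetricGraph (G : Type*) [EMetricSpace G] : Prop :=
  IsLengthMetric G ∧ Nonempty (GraphDecomposition G)

/-- A simple cycle: a closed path without self-intersections apart from its common endpoints. -/
def IsSimpleCycle {G : Type*} [TopologicalSpace G] {x : G} (γ : Path x x) : Prop :=
  ∀ s t : unitInterval, γ s = γ t → s = t ∨ (s = 0 ∧ t = 1) ∨ (s = 1 ∧ t = 0)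

/-- The length of the smallest simple cycle of `G`; it is `∞` if `G` has no simple cycle. -/
def systole (G : Type*) [EMetricSpace G] : ℝ≥0∞ :=
  ⨅ (x : G) (γ : Path x x) (_ : IsSimpleCycle γ), pathLength γ

/-! ### Vietoris-Rips and Čech complexes -/

/-- The Vietoris-Rips complex at scale `β`: the nonempty finite subsets of diameter `< β`. -/
def vietorisRips (G : Type*) [EMetricSpace G] (β : ℝ) : PreAbstractSimplicialComplex G where
  faces := {σ | σ.Nonempty ∧ Metric.ediam (σ : Set G) < ENNReal.ofReal β}
  isRelLowerSet_faces := fun _ h =>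
    ⟨h.1, fun _ hts ht => ⟨ht, (Metric.ediam_mono (Finset.coe_subset.2 hts)).trans_lt h.2⟩⟩

/-- The Čech complex at scale `β`: the nonempty finite subsets such that the open `β`-balls
about their points have a common point. -/
def cech (G : Type*) [EMetricSpace G] (β : ℝ) : PreAbstractSimplicialComplex G where
  faces := {σ | σ.Nonempty ∧ ∃ y : G, ∀ x ∈ σ, edist y x < ENNReal.ofReal β}
  isRelLowerSet_faces := fun _ h =>
    ⟨h.1, fun _ hts ht => ⟨ht, h.2.imp fun _ hy x hx => hy x (hts hx)⟩⟩

theorem vietorisRips_mono (G : Type*) [EMetricSpace G] {β β' : ℝ} (h : β ≤ β') :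
    vietorisRips G β ≤ vietorisRips G β' :=
  fun _ hσ => ⟨hσ.1, hσ.2.trans_le (ENNReal.ofReal_le_ofReal h)⟩

/-! ### Geometric realization -/

/-- The closed simplex spanned by `σ`, in barycentric coordinates. -/
def closedSimplex {ι : Type*} (σ : Finset ι) : Set (ι → ℝ) :=
  {x | (∀ i, 0 ≤ x i) ∧ (∀ i, i ∉ σ → x i = 0) ∧ ∑ i ∈ σ, x i = 1}

/-- The underlying set of the geometric realization of a simplicial complex: the union of
the closed simplices spanned by its faces. -/
def Realization {ι : Type*} (K : PreAbstractSimplicialComplex ι) : Type _ :=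
  {x : ι → ℝ // ∃ σ ∈ K.faces, x ∈ closedSimplex σ}

/-- The inclusion of a closed simplex into the geometric realization. -/
def Realization.ofSimplex {ι : Type*} (K : PreAbstractSimplicialComplex ι) (σ : K.faces)
    (x : closedSimplex σ.1) : Realization K :=
  ⟨x.1, σ.1, σ.2, x.2⟩

/-- The coherent (weak) topology: a set is open iff it meets every closed simplex in an open
subset of that simplex, where the simplex has its Euclidean topology. -/
instance Realization.instTopologicalSpace {ι : Type*} (K : PreAbstractSimplicialComplex ι) :
    TopologicalSpace (Realization K) :=
  ⨆ σ : K.faces, TopologicalSpace.coinduced (Realization.ofSimplex K σ) inferInstance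

/-- The continuous map of realizations induced by the inclusion of a subcomplex. -/
def Realization.inclusion {ι : Type*} {K L : PreAbstractSimplicialComplex ι} (h : K ≤ L) :
    C(Realization K, Realization L) where
  toFun x := ⟨x.1, x.2.imp fun _ hσ => ⟨h hσ.1, hσ.2⟩⟩
  continuous_toFun := by
    refine continuous_iSup_dom.2 fun σ => continuous_coinduced_dom.2 ?_
    exact continuous_iSup_rng (i := (⟨σ.1, h σ.2⟩ : L.faces)) continuous_coinduced_rng

/-- A continuous map is a homotopy equivalence if it has a homotopy inverse. -/
def IsHomotopyEquivalence {X Y : Type*} [TopologicalSpace X] [TopologicalSpace Y]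
    (f : C(X, Y)) : Prop :=
  ∃ e : ContinuousMap.HomotopyEquiv X Y, e.toFun = f

end MetricGraph

end

noncomputable section

namespace MetricGraph

open Topology

/-! ### The geometric realization -/

section Realization

variable {ι : Type*} {K : PreAbstractSimplicialComplex ι}

namespace Realization

/-! Let r be less than a third of the systole. A geodesic triangle with sides shorter than r is a
tripod. Indeed, if a point z of the side from a to b lay on no geodesic from the third vertex p to a
or to b, the other two sides would contain an arc from b to a that misses z; together with the side
through z it would contain a simple cycle no longer than the perimeter (`systole_le_of_avoiding`,
`IsLengthMetric.tripod`).

Tripods make short geodesics unique and continuous in their ends, and small balls convex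
(`IsTripodal.shortGeodesics`). They also put the midpoint of a diametral pair of a finite set within
half the diameter of all its points (`IsTripodal.exists_center`), which turns Rips simplices into
Čech simplices; the converse is the triangle inequality.

For the homotopy type, iterated barycenters along geodesics give a map g from the Rips complex to
the space, and a partition of unity gives a map f back. Geodesics join g ∘ f to the identity. The
other composite is harder, since x and f (g x) need not lie in a common simplex. The vertices of f
are therefore first concentrated near g x, at a scale below the gap between β and the diameter of
the simplex. That diameter jumps with the carrier, so small coordinates are trimmed away and the
continuous function `pairSum` bounds the inverse gap on what survives
(`ShortGeodesics.exists_homotopyEquiv`).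

Barycenters depend only on the coordinates, hence commute with the inclusions between scales, and
the second claim is two-out-of-three. Infinite distances are removed by truncating at r, which
changes neither short distances nor the topology. -/

theorem continuous_iff {Z : Type*} [TopologicalSpace Z] {f : Realization K → Z} :
    Continuous f ↔ ∀ σ : K.faces, Continuous (f ∘ ofSimplex K σ) :=
  continuous_iSup_dom.trans (forall_congr' fun _ => continuous_coinduced_dom)

theorem continuous_ofSimplex (σ : K.faces) : Continuous (ofSimplex K σ) :=
  continuous_iff.1 continuous_id σ

/-- A function on `|K| × Y`, with `Y` locally compact, is continuous if it is so on the product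
of each closed simplex with `Y`. -/
theorem continuous_of_prod {Y Z : Type*} [TopologicalSpace Y] [LocallyCompactSpace Y]
    [TopologicalSpace Z] {f : Realization K × Y → Z}
    (h : ∀ σ : K.faces, Continuous fun q : closedSimplex σ.1 × Y => f (ofSimplex K σ q.1, q.2)) :
    Continuous f := by
  have hx : ∀ x : Realization K, Continuous fun y => f (x, y) := by
    rintro ⟨x, σ, hσ, hx⟩
    exact (h ⟨σ, hσ⟩).comp (Continuous.prodMk_right (⟨x, hx⟩ : closedSimplex σ))
  -- After currying, continuity is tested on each simplex; local compactness of `Y` allows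
  -- uncurrying.
  let F : Realization K → C(Y, Z) := fun x => ⟨fun y => f (x, y), hx x⟩
  have hF : Continuous F := continuous_iff.2 fun σ =>
    ContinuousMap.continuous_of_continuous_uncurry _ (h σ)
  exact ContinuousMap.continuous_uncurry_of_continuous ⟨F, hF⟩

theorem nonneg (x : Realization K) (i : ι) : 0 ≤ x.1 i := by
  obtain ⟨x, σ, hσ, hx⟩ := x
  exact hx.1 i

theorem finite_support (x : Realization K) : (Function.support x.1).Finite := by
  obtain ⟨x, σ, hσ, hx⟩ := x
  refine σ.finite_toSet.subset fun i hi => ?_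
  by_contra h
  exact hi (hx.2.1 i h)

/-- The vertices of the carrier of a point of the realization. -/
def carrier (x : Realization K) : Finset ι := x.finite_support.toFinset

@[simp] theorem mem_carrier {x : Realization K} {i : ι} : i ∈ x.carrier ↔ x.1 i ≠ 0 := by
  simp [carrier]

theorem sum_eq_one (x : Realization K) {σ : Finset ι} (h : x.carrier ⊆ σ) :
    ∑ i ∈ σ, x.1 i = 1 := by
  have key : ∀ τ : Finset ι, x.carrier ⊆ τ → ∑ i ∈ x.carrier, x.1 i = ∑ i ∈ τ, x.1 i :=
    fun τ hτ => Finset.sum_subset hτ fun i _ hi => by simpa using hi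
  rw [← key σ h]
  obtain ⟨τ, hτ, hx⟩ := x.2
  rw [key τ fun i hi => ?_, hx.2.2]
  by_contra hc
  exact mem_carrier.1 hi (hx.2.1 i hc)

theorem mem_closedSimplex (x : Realization K) {σ : Finset ι} (h : x.carrier ⊆ σ) :
    x.1 ∈ closedSimplex σ :=
  ⟨x.nonneg, fun i hi => by simpa using fun hc => hi (h hc), x.sum_eq_one h⟩

theorem carrier_subset_of_mem (x : Realization K) {σ : Finset ι} (h : x.1 ∈ closedSimplex σ) :
    x.carrier ⊆ σ := fun i hi => by
  by_contra hc
  exact mem_carrier.1 hi (h.2.1 i hc)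

theorem carrier_nonempty (x : Realization K) : x.carrier.Nonempty := by
  by_contra h
  have := x.sum_eq_one subset_rfl
  simp [Finset.not_nonempty_iff_eq_empty.1 h] at this

theorem carrier_mem (x : Realization K) : x.carrier ∈ K.faces := by
  obtain ⟨τ, hτ, hx⟩ := x.2
  exact (K.isRelLowerSet_faces hτ).2 (x.carrier_subset_of_mem hx) x.carrier_nonempty

theorem carrier_ofSimplex (σ : K.faces) (x : closedSimplex σ.1) :
    (ofSimplex K σ x).carrier ⊆ σ.1 :=
  carrier_subset_of_mem _ x.2

theorem continuous_coord (i : ι) : Continuous fun x : Realization K => x.1 i :=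
  continuous_iff.2 fun _ => (continuous_apply i).comp continuous_subtype_val

theorem locallyFinite_of_forall_subset {Z : Type*} [TopologicalSpace Z] (σ : Finset ι)
    (s : ι → Set Z) (h : ∀ i, (s i).Nonempty → i ∈ σ) : LocallyFinite s := fun _ =>
  ⟨univ, Filter.univ_mem, σ.finite_toSet.subset fun i hi => h i (hi.mono inter_subset_left)⟩

/-- A map into the realization is continuous if its barycentric coordinates are continuous with
locally finite supports. -/
theorem continuous_of_locallyFinite {Z : Type*} [TopologicalSpace Z] {φ : Z → Realization K}
    (hc : ∀ i, Continuous fun z => (φ z).1 i)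
    (hf : LocallyFinite fun i => {z | (φ z).1 i ≠ 0}) : Continuous φ := by
  classical
  -- The sets of constant carrier have closures that form a locally finite closed cover, and on the
  -- closure of `A σ` the map stays in the closed simplex of `σ`.
  let A : Finset ι → Set Z := fun σ => {z | (φ z).carrier = σ}
  have hA : LocallyFinite A := by
    intro z
    obtain ⟨N, hN, hfin⟩ := hf z
    refine ⟨N, hN, hfin.toFinset.powerset.finite_toSet.subset ?_⟩
    rintro σ ⟨w, rfl, hwN⟩
    refine Finset.mem_coe.2 (Finset.mem_powerset.2 fun i hi => ?_)
    exact hfin.mem_toFinset.2 ⟨w, mem_carrier.1 hi, hwN⟩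
  refine hA.closure.continuous (eq_univ_of_forall fun z => mem_iUnion.2
    ⟨_, subset_closure (rfl : (φ z).carrier = _)⟩) (fun _ => isClosed_closure) fun σ => ?_
  rcases (A σ).eq_empty_or_nonempty with he | ⟨w, hw⟩
  · simp [he]
  have hσ : σ ∈ K.faces := hw ▸ (φ w).carrier_mem
  have hsub : ∀ z ∈ closure (A σ), (φ z).carrier ⊆ σ := by
    intro z hz i hi
    by_contra hiσ
    have hcl : IsClosed {z | (φ z).1 i = 0} := isClosed_eq (hc i) continuous_const
    refine mem_carrier.1 hi (hcl.closure_subset_iff.2 ?_ hz)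
    rintro w rfl
    simpa using hiσ
  have hψ : Continuous fun z : closure (A σ) => (⟨(φ z.1).1,
      (φ z.1).mem_closedSimplex (hsub z.1 z.2)⟩ : closedSimplex σ) :=
    Continuous.subtype_mk (continuous_pi fun i => (hc i).comp continuous_subtype_val) _
  exact continuousOn_iff_continuous_domRestrict.2
    ((continuous_ofSimplex (K := K) ⟨σ, hσ⟩).comp hψ)

/-- The straight segment between two points with a common carrying face. -/
def lineMap (x y : Realization K) (h : ∃ σ ∈ K.faces, x.carrier ⊆ σ ∧ y.carrier ⊆ σ)
    (t : unitInterval) : Realization K :=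
  ⟨fun i => (1 - t) * x.1 i + t * y.1 i, by
    obtain ⟨σ, hσ, hx, hy⟩ := h
    have hx := x.mem_closedSimplex hx
    have hy := y.mem_closedSimplex hy
    refine ⟨σ, hσ, fun i => ?_, fun i hi => ?_, ?_⟩
    · exact add_nonneg (mul_nonneg (by linarith [t.2.2]) (hx.1 i)) (mul_nonneg t.2.1 (hy.1 i))
    · change (1 - _) * x.1 i + _ * y.1 i = 0
      rw [hx.2.1 i hi, hy.2.1 i hi]; ring
    · rw [Finset.sum_add_distrib, ← Finset.mul_sum, ← Finset.mul_sum, hx.2.2, hy.2.2]; ring⟩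

/-- Two maps between realizations that carry each point into a common face, and that have locally
finite coordinates on each simplex, are homotopic. -/
theorem homotopic_of_common_face {κ : Type*} {M : PreAbstractSimplicialComplex κ}
    (f g : C(Realization M, Realization K))
    (h : ∀ x, ∃ σ ∈ K.faces, (f x).carrier ⊆ σ ∧ (g x).carrier ⊆ σ)
    (hf : ∀ σ : M.faces, LocallyFinite fun i => {x | (f (ofSimplex M σ x)).1 i ≠ 0})
    (hg : ∀ σ : M.faces, LocallyFinite fun i => {x | (g (ofSimplex M σ x)).1 i ≠ 0}) :
    f.Homotopic g := by
  have hcont : Continuous fun q : Realization M × unitInterval =>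
      lineMap (f q.1) (g q.1) (h q.1) q.2 := by
    refine continuous_of_prod fun σ => continuous_of_locallyFinite (fun i => ?_) ?_
    · have h1 := (continuous_coord i).comp (f.continuous.comp (continuous_ofSimplex σ))
      have h2 := (continuous_coord i).comp (g.continuous.comp (continuous_ofSimplex σ))
      have ht : Continuous fun q : closedSimplex σ.1 × unitInterval => (q.2 : ℝ) :=
        continuous_subtype_val.comp continuous_snd
      exact ((continuous_const.sub ht).mul (h1.comp continuous_fst)).add
        (ht.mul (h2.comp continuous_fst))
    · intro q
      obtain ⟨N, hN, hNf⟩ := hf σ q.1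
      obtain ⟨N', hN', hNf'⟩ := hg σ q.1
      refine ⟨Prod.fst ⁻¹' (N ∩ N'), continuous_fst.continuousAt.preimage_mem_nhds
        (Filter.inter_mem hN hN'), (hNf.union hNf').subset ?_⟩
      rintro i ⟨w, hw, hwN, hwN'⟩
      by_cases h1 : (f (ofSimplex M σ w.1)).1 i = 0
      · refine Or.inr ⟨w.1, fun h2 => hw ?_, hwN'⟩
        change (1 - _) * (f (ofSimplex M σ w.1)).1 i + _ * (g (ofSimplex M σ w.1)).1 i = 0
        rw [h1, h2]; ring
      · exact Or.inl ⟨w.1, h1, hwN⟩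
  refine ⟨⟨⟨fun q => lineMap (f q.2) (g q.2) (h q.2) q.1, hcont.comp continuous_swap⟩, ?_, ?_⟩⟩
  · intro x
    refine Subtype.ext (funext fun i => ?_)
    simp [lineMap]
  · intro x
    refine Subtype.ext (funext fun i => ?_)
    simp [lineMap]

end Realization

end Realization

/-! ### Short geodesics and iterated barycenters -/

section Weights

variable {X : Type*}

/-- The total mass of the weights `x` on a list of points. -/
def mass (x : X → ℝ) (l : List X) : ℝ := (l.map x).sum

@[simp] theorem mass_cons (x : X → ℝ) (p : X) (l : List X) :
    mass x (p :: l) = x p + mass x l := by simp [mass]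

theorem mass_nonneg {x : X → ℝ} (hx : ∀ p, 0 ≤ x p) (l : List X) : 0 ≤ mass x l := by
  induction l with
  | nil => simp [mass]
  | cons p l ih => rw [mass_cons]; exact add_nonneg (hx p) ih

open Classical in
theorem mass_filter (x : X → ℝ) (l : List X) : mass x (l.filter (x · ≠ 0)) = mass x l := by
  induction l with
  | nil => rfl
  | cons p l ih =>
    by_cases hp : x p = 0
    · rw [List.filter_cons_of_neg (by simpa using hp), ih, mass_cons, hp, zero_add]
    · rw [List.filter_cons_of_pos (by simpa using hp), mass_cons, mass_cons, ih]

theorem continuous_mass {Z : Type*} [TopologicalSpace Z] {φ : Z → X → ℝ}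
    (hφ : ∀ p, Continuous fun z => φ z p) (l : List X) : Continuous fun z => mass (φ z) l := by
  induction l with
  | nil => exact continuous_const
  | cons p l ih => simp only [mass_cons]; exact (hφ p).add ih

/-- A well-ordering of the points, used to iterate barycenters. -/
abbrev pointOrder (X : Type*) : LinearOrder X :=
  letI := Classical.decRel (WellOrderingRel (α := X))
  linearOrderOfSTO WellOrderingRel

/-- The points of a finite set, listed in a fixed order. -/
def listing (σ : Finset X) : List X := letI := pointOrder X; σ.sort

@[simp] theorem mem_listing {σ : Finset X} {p : X} : p ∈ listing σ ↔ p ∈ σ := by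
  let := pointOrder X
  exact Finset.mem_sort _

theorem mass_listing (x : X → ℝ) (σ : Finset X) : mass x (listing σ) = ∑ p ∈ σ, x p := by
  let := pointOrder X
  rw [Finset.sum, ← Finset.sort_eq σ (· ≤ ·), Multiset.map_coe, Multiset.sum_coe]
  rfl

end Weights

/-- A continuous choice of geodesics between the points at distance less than `r`, for which
all balls of radius at most `r` are convex. -/
structure ShortGeodesics (X : Type*) [MetricSpace X] (r : ℝ) where
  /-- the point at time `t` on the geodesic from `a` to `b` -/
  geo : X → X → ℝ → X
  geo_zero : ∀ a b, geo a b 0 = a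
  dist_geo_right : ∀ a b t, dist a b < r → t ∈ Icc (0 : ℝ) 1 →
    dist (geo a b t) b ≤ (1 - t) * dist a b
  dist_geo_lt : ∀ a b t q c, dist a b < r → t ∈ Icc (0 : ℝ) 1 → c ≤ r → dist q a < c →
    dist q b < c → dist q (geo a b t) < c
  continuousOn_geo : ContinuousOn (fun q : X × X × ℝ => geo q.1 q.2.1 q.2.2)
    {q | dist q.1 q.2.1 < r ∧ q.2.2 ∈ Icc (0 : ℝ) 1}

namespace ShortGeodesics

variable {X : Type*} [MetricSpace X] {r : ℝ} (S : ShortGeodesics X r)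

theorem geo_one {a b : X} (h : dist a b < r) : S.geo a b 1 = b := by
  have := S.dist_geo_right a b 1 h ⟨zero_le_one, le_rfl⟩
  rw [sub_self, zero_mul] at this
  exact dist_le_zero.1 this

open Classical in
/-- The iterated barycenter of the points of a list with weights `x`: the barycenter of the tail
is moved towards the head in proportion to the weights. -/
def listBary [Nonempty X] (x : X → ℝ) : List X → X
  | [] => Classical.arbitrary X
  | p :: l =>
    if x p = 0 then listBary x l
    else if mass x l = 0 then p
    else S.geo (listBary x l) p (x p / (x p + mass x l))

variable [Nonempty X]

open Classical in
theorem listBary_filter (x : X → ℝ) (l : List X) :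
    S.listBary x (l.filter (x · ≠ 0)) = S.listBary x l := by
  induction l with
  | nil => rfl
  | cons p l ih =>
    by_cases hp : x p = 0
    · rw [List.filter_cons_of_neg (by simpa using hp), ih, listBary, if_pos hp]
    · rw [List.filter_cons_of_pos (by simpa using hp), listBary, listBary, ih, mass_filter]

open Classical in
/-- The iterated barycenter of a finitely supported family of weights. -/
def bary (x : X → ℝ) : X :=
  if h : (Function.support x).Finite then S.listBary x (listing h.toFinset)
  else Classical.arbitrary X

/-- Both listings follow the same order of the points, so they agree once the zero weights are
discarded, and these do not affect the barycenter. Any face that contains the support may thus be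
used. -/
theorem bary_eq {x : X → ℝ} {σ : Finset X} (h : ∀ p, p ∉ σ → x p = 0) :
    S.bary x = S.listBary x (listing σ) := by
  classical
  have hfin : (Function.support x).Finite := σ.finite_toSet.subset fun p hp => by
    by_contra hc
    exact hp (h p hc)
  rw [bary, dif_pos hfin, ← S.listBary_filter x (listing σ)]
  congr 1
  let := pointOrder X
  unfold listing
  refine List.Perm.eq_of_pairwise' (r := (· ≤ ·)) (Finset.pairwise_sort _ _)
    ((Finset.pairwise_sort _ _).filter _) ?_
  rw [List.perm_ext_iff_of_nodup (Finset.sort_nodup _ _) ((Finset.sort_nodup _ _).filter _)]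
  intro p
  simp only [Finset.mem_sort, Set.Finite.mem_toFinset, Function.mem_support, List.mem_filter,
    decide_eq_true_eq]
  exact ⟨fun hp => ⟨by by_contra hc; exact hp (h p hc), hp⟩, fun hp => hp.2⟩

theorem div_mem {a b : ℝ} (ha : 0 ≤ a) (hb : 0 ≤ b) : a / (a + b) ∈ Icc (0 : ℝ) 1 :=
  ⟨by positivity, div_le_one_of_le₀ (by linarith) (by linarith)⟩

/-- Balls are convex along short geodesics. The induction runs over all centres at once because it
is also needed with centre the head `p` and radius `r`, to know that the geodesic towards `p` is
short. -/
theorem dist_listBary_lt {x : X → ℝ} (hx : ∀ p, 0 ≤ x p) {l : List X}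
    (hl : ∀ p ∈ l, ∀ p' ∈ l, dist p p' < r) (hm : mass x l ≠ 0) {q : X} {c : ℝ} (hc : c ≤ r)
    (hq : ∀ p ∈ l, x p ≠ 0 → dist q p < c) : dist q (S.listBary x l) < c := by
  induction l generalizing q c with
  | nil => simp [mass] at hm
  | cons p l ih =>
    have hl' : ∀ p ∈ l, ∀ p' ∈ l, dist p p' < r := fun p hp p' hp' =>
      hl p (List.mem_cons_of_mem _ hp) p' (List.mem_cons_of_mem _ hp')
    have hq' : ∀ p ∈ l, x p ≠ 0 → dist q p < c := fun p hp => hq p (List.mem_cons_of_mem _ hp)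
    rw [listBary]
    split_ifs with h1 h2
    · exact ih hl' (by simpa [h1] using hm) hc hq'
    · exact hq p List.mem_cons_self h1
    · refine S.dist_geo_lt _ _ _ _ _ ?_ (div_mem (hx p) (mass_nonneg hx l)) hc
        (ih hl' h2 hc hq') (hq p List.mem_cons_self h1)
      rw [dist_comm]
      exact ih hl' h2 le_rfl fun p' hp' _ => hl p List.mem_cons_self p' (List.mem_cons_of_mem _ hp')

theorem continuousAt_listBary {Z : Type*} [TopologicalSpace Z] {φ : Z → X → ℝ}
    (hφ : ∀ p, Continuous fun z => φ z p) (h0 : ∀ z p, 0 ≤ φ z p) {l : List X}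
    (hl : ∀ p ∈ l, ∀ p' ∈ l, dist p p' < r) {z₀ : Z} (hm : mass (φ z₀) l ≠ 0) :
    ContinuousAt (fun z => S.listBary (φ z) l) z₀ := by
  induction l with
  | nil => simp [mass] at hm
  | cons p l ih =>
    have hl' : ∀ p ∈ l, ∀ p' ∈ l, dist p p' < r := fun p hp p' hp' =>
      hl p (List.mem_cons_of_mem _ hp) p' (List.mem_cons_of_mem _ hp')
    have hdist : ∀ z, mass (φ z) l ≠ 0 → dist (S.listBary (φ z) l) p < r := fun z hz => by
      rw [dist_comm]
      exact S.dist_listBary_lt (h0 z) hl' hz le_rfl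
        fun p' hp' _ => hl p List.mem_cons_self p' (List.mem_cons_of_mem _ hp')
    have hfrac : ContinuousAt (fun z => φ z p / (φ z p + mass (φ z) l)) z₀ :=
      (hφ p).continuousAt.div ((hφ p).add (continuous_mass hφ l)).continuousAt (by simpa using hm)
    -- When the tail has no mass at `z₀`, its barycenter need not converge; but the geodesic
    -- parameter tends to 1, which forces the point towards `p`.
    by_cases hz : mass (φ z₀) l = 0
    · have hp : φ z₀ p ≠ 0 := by simpa [hz] using hm
      have hval : S.listBary (φ z₀) (p :: l) = p := by rw [listBary, if_neg hp, if_pos hz]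
      have hr : 0 < r := dist_nonneg.trans_lt (hl p List.mem_cons_self p List.mem_cons_self)
      rw [ContinuousAt, hval, tendsto_iff_dist_tendsto_zero]
      have hlim : Filter.Tendsto (fun z => (1 - φ z p / (φ z p + mass (φ z) l)) * r) (𝓝 z₀)
          (𝓝 0) := by
        have := (tendsto_const_nhds (x := (1 : ℝ))).sub hfrac.tendsto |>.mul_const r
        simpa [hz, hp] using this
      refine squeeze_zero' (Filter.Eventually.of_forall fun _ => dist_nonneg) ?_ hlim
      filter_upwards [(hφ p).continuousAt.eventually_ne hp] with z hzp
      have hmem := div_mem (h0 z p) (mass_nonneg (h0 z) l)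
      rw [listBary, if_neg hzp]
      split_ifs with h2
      · rw [dist_self]
        exact mul_nonneg (by linarith [hmem.2]) hr.le
      · exact (S.dist_geo_right _ _ _ (hdist z h2) hmem).trans
          (mul_le_mul_of_nonneg_left (hdist z h2).le (by linarith [hmem.2]))
    · have hev : ∀ᶠ z in 𝓝 z₀, mass (φ z) l ≠ 0 :=
        (continuous_mass hφ l).continuousAt.eventually_ne hz
      have heq : ∀ z, mass (φ z) l ≠ 0 → S.listBary (φ z) (p :: l) =
          S.geo (S.listBary (φ z) l) p (φ z p / (φ z p + mass (φ z) l)) := fun z hz => by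
        rw [listBary, if_neg hz]
        split_ifs with h1
        · rw [h1, zero_div, S.geo_zero]
        · rfl
      refine ContinuousAt.congr ?_ (hev.mono fun z hz => (heq z hz).symm)
      have hmem : ∀ z, φ z p / (φ z p + mass (φ z) l) ∈ Icc (0 : ℝ) 1 := fun z =>
        div_mem (h0 z p) (mass_nonneg (h0 z) l)
      have hT : Filter.Tendsto (fun z => (S.listBary (φ z) l, p,
          φ z p / (φ z p + mass (φ z) l))) (𝓝 z₀)
          (𝓝[{q | dist q.1 q.2.1 < r ∧ q.2.2 ∈ Icc (0 : ℝ) 1}] (S.listBary (φ z₀) l, p,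
          φ z₀ p / (φ z₀ p + mass (φ z₀) l))) :=
        tendsto_nhdsWithin_iff.2 ⟨((ih hl' hz).tendsto.prodMk_nhds
          (tendsto_const_nhds.prodMk_nhds hfrac.tendsto)),
          hev.mono fun z hz => ⟨hdist z hz, hmem z⟩⟩
      exact (S.continuousOn_geo _ ⟨hdist z₀ hz, hmem z₀⟩).tendsto.comp hT

variable {K : PreAbstractSimplicialComplex X}

theorem continuous_bary (hK : ∀ σ ∈ K.faces, ∀ p ∈ σ, ∀ p' ∈ σ, dist p p' < r) :
    Continuous fun x : Realization K => S.bary x.1 := by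
  refine Realization.continuous_iff.2 fun σ => continuous_iff_continuousAt.2 fun x₀ => ?_
  have : (fun x : Realization K => S.bary x.1) ∘ Realization.ofSimplex K σ =
      fun x => S.listBary x.1 (listing σ.1) := funext fun x => S.bary_eq x.2.2.1
  rw [this]
  refine S.continuousAt_listBary (φ := fun x : closedSimplex σ.1 => x.1)
    (fun p => (continuous_apply p).comp continuous_subtype_val) (fun z p => z.2.1 p)
    (fun p hp p' hp' => hK _ σ.2 p (mem_listing.1 hp) p' (mem_listing.1 hp')) ?_
  rw [mass_listing, x₀.2.2.2]
  exact one_ne_zero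

theorem dist_bary_lt (hK : ∀ σ ∈ K.faces, ∀ p ∈ σ, ∀ p' ∈ σ, dist p p' < r)
    (x : Realization K) {q : X} {c : ℝ} (hc : c ≤ r) (hq : ∀ p ∈ x.carrier, dist q p < c) :
    dist q (S.bary x.1) < c := by
  rw [S.bary_eq (σ := x.carrier) (fun p hp => by simpa using hp)]
  refine S.dist_listBary_lt x.nonneg (fun p hp p' hp' => hK _ x.carrier_mem p (mem_listing.1 hp) p'
    (mem_listing.1 hp')) ?_ hc fun p hp _ => hq p (mem_listing.1 hp)
  rw [mass_listing, x.sum_eq_one subset_rfl]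
  exact one_ne_zero

end ShortGeodesics

/-! ### Trimming small weights -/

namespace Realization

variable {ι : Type*} {K : PreAbstractSimplicialComplex ι}

/-- The sum of the squares of the barycentric coordinates. -/
def sqSum (x : Realization K) : ℝ := ∑ p ∈ x.carrier, x.1 p ^ 2

theorem sqSum_eq (x : Realization K) {σ : Finset ι} (h : x.carrier ⊆ σ) :
    x.sqSum = ∑ p ∈ σ, x.1 p ^ 2 :=
  Finset.sum_subset h fun p _ hp => by simp [show x.1 p = 0 by simpa using hp]

theorem sqSum_pos (x : Realization K) : 0 < x.sqSum :=
  Finset.sum_pos (fun _ hp => pow_pos ((x.nonneg _).lt_of_ne' (mem_carrier.1 hp)) 2)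
    x.carrier_nonempty

theorem continuous_sqSum : Continuous (sqSum : Realization K → ℝ) :=
  continuous_iff.2 fun σ => by
    have : sqSum ∘ ofSimplex K σ = fun x => ∑ p ∈ σ.1, x.1 p ^ 2 :=
      funext fun x => sqSum_eq _ (carrier_ofSimplex σ x)
    rw [this]
    exact continuous_finsetSum _ fun p _ =>
      ((continuous_apply p).comp continuous_subtype_val).pow 2

/-- The excess of a barycentric coordinate over half of the sum of the squares. -/
def excess (x : Realization K) (p : ι) : ℝ := max 0 (x.1 p - x.sqSum / 2)

theorem excess_nonneg (x : Realization K) (p : ι) : 0 ≤ x.excess p := le_max_left _ _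

theorem excess_eq_zero (x : Realization K) {p : ι} (hp : p ∉ x.carrier) : x.excess p = 0 :=
  max_eq_left (by linarith [x.sqSum_pos, show x.1 p = 0 by simpa using hp])

theorem lt_of_excess_ne_zero (x : Realization K) {p : ι} (hp : x.excess p ≠ 0) :
    x.sqSum / 2 < x.1 p := by
  by_contra h
  exact hp (max_eq_left (by linarith))

theorem continuous_excess (p : ι) : Continuous fun x : Realization K => x.excess p :=
  continuous_const.max ((continuous_coord p).sub (continuous_sqSum.div_const 2))

/-- The total excess. -/
def excessSum (x : Realization K) : ℝ := ∑ p ∈ x.carrier, x.excess p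

theorem excessSum_eq (x : Realization K) {σ : Finset ι} (h : x.carrier ⊆ σ) :
    x.excessSum = ∑ p ∈ σ, x.excess p :=
  Finset.sum_subset h fun _ _ hp => x.excess_eq_zero hp

/-- The sum of squares is the mean of the coordinates weighted by themselves, so they cannot all be
at most half of it. -/
theorem excessSum_pos (x : Realization K) : 0 < x.excessSum := by
  refine Finset.sum_pos' (fun p _ => x.excess_nonneg p) ?_
  by_contra! h
  have hle : ∀ p ∈ x.carrier, x.1 p ^ 2 ≤ x.1 p * (x.sqSum / 2) := fun p hp => by
    have h1 := h p hp
    have h2 : x.1 p - x.sqSum / 2 ≤ 0 := (le_max_right _ _).trans h1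
    nlinarith [x.nonneg p]
  have := Finset.sum_le_sum hle
  rw [← Finset.sum_mul, x.sum_eq_one subset_rfl] at this
  change x.sqSum ≤ _ at this
  linarith [x.sqSum_pos]

theorem continuous_excessSum : Continuous (excessSum : Realization K → ℝ) :=
  continuous_iff.2 fun σ => by
    have : excessSum ∘ ofSimplex K σ = fun x => ∑ p ∈ σ.1, (ofSimplex K σ x).excess p :=
      funext fun x => excessSum_eq _ (carrier_ofSimplex σ x)
    rw [this]
    exact continuous_finsetSum _ fun p _ => (continuous_excess p).comp (continuous_ofSimplex σ)

/-- The point obtained by dropping the small barycentric coordinates. -/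
def trimPoint (x : Realization K) : Realization K :=
  ⟨fun p => x.excess p / x.excessSum, x.carrier, x.carrier_mem,
    fun p => div_nonneg (x.excess_nonneg p) x.excessSum_pos.le,
    fun p hp => by simp [x.excess_eq_zero hp],
    by rw [← Finset.sum_div]; exact div_self x.excessSum_pos.ne'⟩

theorem trimPoint_apply (x : Realization K) (p : ι) :
    x.trimPoint.1 p = x.excess p / x.excessSum := rfl

theorem lt_of_mem_carrier_trimPoint {x : Realization K} {p : ι} (hp : p ∈ x.trimPoint.carrier) :
    x.sqSum / 2 < x.1 p := by
  refine x.lt_of_excess_ne_zero fun h => mem_carrier.1 hp ?_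
  rw [trimPoint_apply, h, zero_div]

theorem carrier_trimPoint_subset (x : Realization K) : x.trimPoint.carrier ⊆ x.carrier :=
  fun p hp => by
    by_contra h
    refine mem_carrier.1 hp ?_
    rw [trimPoint_apply, x.excess_eq_zero h, zero_div]

theorem locallyFinite_id (σ : K.faces) :
    LocallyFinite fun p => {x | (ofSimplex K σ x).1 p ≠ 0} :=
  locallyFinite_of_forall_subset σ.1 _ fun _ ⟨x, hx⟩ => carrier_ofSimplex σ x (mem_carrier.2 hx)

theorem locallyFinite_trimPoint (σ : K.faces) :
    LocallyFinite fun p => {x | (ofSimplex K σ x).trimPoint.1 p ≠ 0} :=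
  locallyFinite_of_forall_subset σ.1 _ fun _ ⟨x, hx⟩ =>
    carrier_ofSimplex σ x (carrier_trimPoint_subset _ (mem_carrier.2 hx))

/-- Dropping the small barycentric coordinates, as a continuous map. -/
def trim (K : PreAbstractSimplicialComplex ι) : C(Realization K, Realization K) where
  toFun := trimPoint
  continuous_toFun := continuous_iff.2 fun σ => continuous_of_locallyFinite
    (fun p => ((continuous_excess p).div continuous_excessSum fun x => x.excessSum_pos.ne').comp
      (continuous_ofSimplex σ)) (locallyFinite_trimPoint σ)

theorem trim_homotopic_id : (trim K).Homotopic (ContinuousMap.id _) :=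
  homotopic_of_common_face _ _
    (fun x => ⟨x.carrier, x.carrier_mem, x.carrier_trimPoint_subset, subset_rfl⟩)
    locallyFinite_trimPoint locallyFinite_id

/-- A weighted sum of a function of pairs of vertices, which bounds that function on the pairs of
vertices that survive trimming. -/
def pairSum (w : ι → ι → ℝ) (x : Realization K) : ℝ :=
  ∑ p ∈ x.carrier, ∑ q ∈ x.carrier, 4 * x.1 p * x.1 q / x.sqSum ^ 2 * w p q

/-- The coefficients vanish with the coordinates, so nothing jumps when the carrier changes. -/
theorem continuous_pairSum (w : ι → ι → ℝ) : Continuous (pairSum (K := K) w) :=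
  continuous_iff.2 fun σ => by
    have : pairSum w ∘ ofSimplex K σ = fun x => ∑ p ∈ σ.1, ∑ q ∈ σ.1,
        4 * (ofSimplex K σ x).1 p * (ofSimplex K σ x).1 q / (ofSimplex K σ x).sqSum ^ 2 * w p q := by
      funext x
      have hs := carrier_ofSimplex σ x
      have h0 : ∀ p, p ∉ (ofSimplex K σ x).carrier → (ofSimplex K σ x).1 p = 0 := fun p hp => by
        simpa using hp
      change pairSum w (ofSimplex K σ x) = _
      rw [pairSum, Finset.sum_subset hs fun p _ hp =>
        Finset.sum_eq_zero fun q _ => by rw [h0 p hp]; ring]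
      exact Finset.sum_congr rfl fun p _ => Finset.sum_subset hs fun q _ hq => by
        rw [h0 q hq]; ring
    rw [this]
    have hc : ∀ p, Continuous fun x => (ofSimplex K σ x).1 p := fun p =>
      (continuous_coord p).comp (continuous_ofSimplex σ)
    exact continuous_finsetSum _ fun p _ => continuous_finsetSum _ fun q _ =>
      (((continuous_const.mul (hc p)).mul (hc q)).div
        ((continuous_sqSum.comp (continuous_ofSimplex σ)).pow 2)
        fun x => (pow_pos (sqSum_pos _) 2).ne').mul_const _

/-- Surviving coordinates exceed half the sum of squares, so the coefficient of their pair is at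
least 1; the other terms are nonnegative. -/
theorem le_pairSum {w : ι → ι → ℝ} {x : Realization K}
    (hw : ∀ p ∈ x.carrier, ∀ q ∈ x.carrier, 0 ≤ w p q) {p q : ι}
    (hp : p ∈ x.trimPoint.carrier) (hq : q ∈ x.trimPoint.carrier) : w p q ≤ pairSum w x := by
  have hp' := x.carrier_trimPoint_subset hp
  have hq' := x.carrier_trimPoint_subset hq
  have hS := x.sqSum_pos
  have hterm : ∀ p ∈ x.carrier, ∀ q ∈ x.carrier,
      0 ≤ 4 * x.1 p * x.1 q / x.sqSum ^ 2 * w p q := fun p hp q hq =>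
    mul_nonneg (div_nonneg (mul_nonneg (mul_nonneg (by norm_num) (x.nonneg p)) (x.nonneg q))
      (by positivity)) (hw p hp q hq)
  have h1 : 1 ≤ 4 * x.1 p * x.1 q / x.sqSum ^ 2 := by
    rw [le_div_iff₀ (by positivity)]
    have := mul_le_mul (lt_of_mem_carrier_trimPoint hp).le (lt_of_mem_carrier_trimPoint hq).le
      (by positivity) (x.nonneg p)
    nlinarith
  calc w p q ≤ 4 * x.1 p * x.1 q / x.sqSum ^ 2 * w p q := le_mul_of_one_le_left (hw p hp' q hq') h1
    _ ≤ ∑ q ∈ x.carrier, 4 * x.1 p * x.1 q / x.sqSum ^ 2 * w p q :=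
      Finset.single_le_sum (f := fun q => 4 * x.1 p * x.1 q / x.sqSum ^ 2 * w p q)
        (hterm p hp') hq'
    _ ≤ pairSum w x := Finset.single_le_sum
      (f := fun p => ∑ q ∈ x.carrier, 4 * x.1 p * x.1 q / x.sqSum ^ 2 * w p q)
      (fun p hp => Finset.sum_nonneg (hterm p hp)) hp'

end Realization

/-! ### The homotopy equivalence -/

section Hausmann

variable {X : Type*} [MetricSpace X] {K : PreAbstractSimplicialComplex X} {β : ℝ}

/-- The complex `K` is the Vietoris-Rips complex at scale `β` of a metric space: its faces are the
nonempty finite sets of points at pairwise distance less than `β`. -/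
def IsVietorisRips (K : PreAbstractSimplicialComplex X) (β : ℝ) : Prop :=
  ∀ σ : Finset X, σ ∈ K.faces ↔ σ.Nonempty ∧ ∀ p ∈ σ, ∀ q ∈ σ, dist p q < β

/-- A continuous family, parametrized by a scale, of maps to the Vietoris-Rips complex carrying
each point to a simplex with nearby vertices. -/
theorem exists_spread (hβ : 0 < β) (hK : IsVietorisRips K β) :
    ∃ F : C(X × ℝ, Realization K),
      (∀ z, ∀ p ∈ (F z).carrier, dist z.1 p < β / 2 ∧ z.2 * dist z.1 p < 1) ∧
      LocallyFinite fun p => {z | (F z).1 p ≠ 0} := by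
  -- The second coordinate is an inverse scale: at 0 its condition is void, and large values force
  -- the vertices close to the point. The bound `β / 2` keeps the vertices less than `β` apart.
  let U : X → Set (X × ℝ) := fun p => {z | dist z.1 p < β / 2 ∧ z.2 * dist z.1 p < 1}
  have hU : ∀ p, IsOpen (U p) := fun p =>
    (isOpen_lt (f := fun z : X × ℝ => dist z.1 p) (by fun_prop) continuous_const).inter
      (isOpen_lt (f := fun z : X × ℝ => z.2 * dist z.1 p) (by fun_prop) continuous_const)
  obtain ⟨φ, hφ⟩ := PartitionOfUnity.exists_isSubordinate isClosed_univ U hU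
    fun z _ => mem_iUnion.2 ⟨z.1, by simp [U, hβ]⟩
  have hsupp : ∀ z p, φ p z ≠ 0 → dist z.1 p < β / 2 ∧ z.2 * dist z.1 p < 1 := fun z p hp =>
    hφ p (subset_closure hp)
  have hfin : ∀ z, {p | φ p z ≠ 0}.Finite := fun z => φ.locallyFinite.point_finite z
  have hsum : ∀ z, ∑ p ∈ (hfin z).toFinset, φ p z = 1 := fun z => by
    rw [← φ.sum_eq_one (mem_univ z)]
    exact (finsum_eq_sum_of_support_subset _ (by simp [Function.support])).symm
  have hface : ∀ z, (hfin z).toFinset ∈ K.faces := fun z => by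
    refine (hK _).2 ⟨?_, fun p hp q hq => ?_⟩
    · by_contra h
      have := hsum z
      simp [Finset.not_nonempty_iff_eq_empty.1 h] at this
    · have h1 := (hsupp z p (by simpa using hp)).1
      have h2 := (hsupp z q (by simpa using hq)).1
      linarith [dist_triangle_left p q z.1]
  let F : X × ℝ → Realization K := fun z => ⟨fun p => φ p z, (hfin z).toFinset, hface z,
    fun p => φ.nonneg p z, fun p hp => by simpa using hp, hsum z⟩
  have hlf : LocallyFinite fun p => {z | (F z).1 p ≠ 0} := φ.locallyFinite
  refine ⟨⟨F, Realization.continuous_of_locallyFinite (fun p => (φ p).continuous) hlf⟩,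
    fun z p hp => hsupp z p (Realization.mem_carrier.1 hp), hlf⟩

variable {r : ℝ} (S : ShortGeodesics X r)

/-- For a space with short geodesics at scale `r`, the iterated barycenter is a homotopy
equivalence from the Vietoris-Rips complex at each scale `β ≤ r` to the space. -/
theorem ShortGeodesics.exists_homotopyEquiv [Nonempty X] (hβ : 0 < β) (hβr : β ≤ r)
    (hK : IsVietorisRips K β) :
    ∃ e : ContinuousMap.HomotopyEquiv (Realization K) X, ∀ x, e.toFun x = S.bary x.1 := by
  have hKβ : ∀ σ ∈ K.faces, ∀ p ∈ σ, ∀ q ∈ σ, dist p q < β := fun σ hσ => ((hK σ).1 hσ).2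
  have hKr : ∀ σ ∈ K.faces, ∀ p ∈ σ, ∀ q ∈ σ, dist p q < r := fun σ hσ p hp q hq =>
    (hKβ σ hσ p hp q hq).trans_le hβr
  obtain ⟨F, hF, hFlf⟩ := exists_spread hβ hK
  let g : C(Realization K, X) := ⟨fun x => S.bary x.1, S.continuous_bary hKr⟩
  let f : C(X, Realization K) := F.comp ⟨fun y => (y, 0), by fun_prop⟩
  have hgf : (g.comp f).Homotopic (ContinuousMap.id X) := by
    have hd : ∀ y, dist y (g (f y)) < r := fun y =>
      (S.dist_bary_lt hKr (f y) (c := β / 2) (by linarith) fun p hp => (hF (y, 0) p hp).1).trans_le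
        (by linarith)
    have hd' : ∀ y, dist (g (f y)) y < r := fun y => by rw [dist_comm]; exact hd y
    refine ⟨⟨⟨fun q => S.geo (g (f q.2)) q.2 q.1, ?_⟩, fun y => S.geo_zero _ _,
      fun y => S.geo_one (hd' y)⟩⟩
    exact S.continuousOn_geo.comp_continuous
      (f := fun q : unitInterval × X => (g (f q.2), q.2, (q.1 : ℝ))) (by fun_prop)
      fun q => ⟨hd' q.2, q.1.2⟩
  -- With this weight, `w p q * d < 1` says that `d` is less than half the gap `β - dist p q`.
  let w : X → X → ℝ := fun p q => 2 / (β - dist p q)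
  have hw : ∀ x : Realization K, ∀ p ∈ x.carrier, ∀ q ∈ x.carrier, 0 ≤ w p q :=
    fun x p hp q hq => div_nonneg zero_le_two
      (by linarith [hKβ _ x.carrier_mem p hp q hq])
  let s : C(Realization K, ℝ) := ⟨Realization.pairSum w, Realization.continuous_pairSum w⟩
  let T := Realization.trim K
  let A : C(Realization K, Realization K) := F.comp ⟨fun x => (g (T x), s x), by fun_prop⟩
  have hTA : T.Homotopic A := by
    classical
    refine Realization.homotopic_of_common_face T A (fun x => ⟨(T x).carrier ∪ (A x).carrier, ?_,
      Finset.subset_union_left, Finset.subset_union_right⟩) Realization.locallyFinite_trimPoint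
      fun σ => hFlf.preimage_continuous (g := fun x => (g (T (Realization.ofSimplex K σ x)),
        s (Realization.ofSimplex K σ x))) ?_
    · have hTT := hKβ _ (T x).carrier_mem
      have hAA := hKβ _ (A x).carrier_mem
      have hTA : ∀ p ∈ (T x).carrier, ∀ q ∈ (A x).carrier, dist p q < β := by
        -- Let δ be the diameter of the trimmed carrier, attained at `p₀, q₀`. Convexity puts the
        -- barycenter within (β + δ) / 2 of each trimmed vertex, and the scale puts the vertices of
        -- `A x` within (β - δ) / 2 of the barycenter; the radii add up to β.
        obtain ⟨⟨p₀, q₀⟩, hpq, hmax⟩ := Finset.exists_max_image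
          ((T x).carrier ×ˢ (T x).carrier) (fun z => dist z.1 z.2)
          ((T x).carrier_nonempty.product (T x).carrier_nonempty)
        obtain ⟨hp₀, hq₀⟩ := Finset.mem_product.1 hpq
        have hδ := hTT p₀ hp₀ q₀ hq₀
        intro p hp q hq
        have h1 : dist p (g (T x)) < (β + dist p₀ q₀) / 2 := by
          refine S.dist_bary_lt hKr (T x) (by linarith) fun p' hp' => ?_
          have : dist p p' ≤ dist p₀ q₀ := hmax (p, p') (Finset.mem_product.2 ⟨hp, hp'⟩)
          linarith
        have h2 := (hF _ q hq).2
        change s x * dist (g (T x)) q < 1 at h2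
        have h3 : w p₀ q₀ ≤ s x := Realization.le_pairSum (hw x) hp₀ hq₀
        have h4 : w p₀ q₀ * dist (g (T x)) q < 1 :=
          (mul_le_mul_of_nonneg_right h3 dist_nonneg).trans_lt h2
        have h5 : dist (g (T x)) q < (β - dist p₀ q₀) / 2 := by
          have h6 : 0 < β - dist p₀ q₀ := by linarith
          simp only [w] at h4
          rw [div_mul_eq_mul_div, div_lt_one h6] at h4
          linarith
        linarith [dist_triangle p (g (T x)) q]
      refine (hK _).2 ⟨(T x).carrier_nonempty.mono Finset.subset_union_left, fun p hp q hq => ?_⟩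
      rcases Finset.mem_union.1 hp with hp | hp <;> rcases Finset.mem_union.1 hq with hq | hq
      · exact hTT p hp q hq
      · exact hTA p hp q hq
      · rw [dist_comm]; exact hTA q hq p hp
      · exact hAA p hp q hq
    · have := Realization.continuous_ofSimplex (K := K) σ
      fun_prop
  -- The inverse scale is lowered to 0, where `F` becomes `f`.
  have hAf : A.Homotopic ((f.comp g).comp T) := by
    refine ⟨⟨⟨fun q => F (g (T q.2), (1 - q.1) * s q.2), by fun_prop⟩, fun x => ?_, fun x => ?_⟩⟩
    · simp [A]
    · simp [f]
  have hfg : (f.comp g).Homotopic (ContinuousMap.id (Realization K)) :=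
    ((Realization.trim_homotopic_id.symm.trans (hTA.trans hAf)).trans
      ((ContinuousMap.Homotopic.refl (f.comp g)).comp Realization.trim_homotopic_id)).symm
  exact ⟨⟨g, f, hfg, hgf⟩, fun _ => rfl⟩

end Hausmann

/-! ### Truncated metrics -/

section Truncation

variable {G : Type*} [EMetricSpace G]

/-- An extended distance, truncated at `M`. -/
def truncDist (M : ℝ) (x y : G) : ℝ := (min (edist x y) (ENNReal.ofReal M)).toReal

theorem ofReal_truncDist (M : ℝ) (x y : G) :
    ENNReal.ofReal (truncDist M x y) = min (edist x y) (ENNReal.ofReal M) :=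
  ENNReal.ofReal_toReal (min_lt_of_right_lt ENNReal.ofReal_lt_top).ne

theorem truncDist_nonneg (M : ℝ) (x y : G) : 0 ≤ truncDist M x y := ENNReal.toReal_nonneg

theorem truncDist_lt_iff {M c : ℝ} (hc : c ≤ M) {x y : G} :
    truncDist M x y < c ↔ edist x y < ENNReal.ofReal c := by
  rcases le_or_gt c 0 with h | h
  · rw [ENNReal.ofReal_of_nonpos h]
    exact iff_of_false (not_lt.2 (h.trans (truncDist_nonneg M x y))) not_lt_zero
  · rw [← ENNReal.ofReal_lt_ofReal_iff h, ofReal_truncDist, min_lt_iff, or_iff_left]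
    exact not_lt.2 (ENNReal.ofReal_le_ofReal hc)

theorem edist_eq_of_truncDist_lt {M : ℝ} {x y : G} (h : truncDist M x y < M) :
    edist x y = ENNReal.ofReal (truncDist M x y) := by
  rw [ofReal_truncDist, min_eq_left ((truncDist_lt_iff le_rfl).1 h).le]

/-- The truncation at `M > 0` of an extended metric, as a metric with the same topology. -/
abbrev truncMetric (G : Type*) [EMetricSpace G] {M : ℝ} (hM : 0 < M) : MetricSpace G :=
  MetricSpace.ofDistTopology (truncDist M) (fun x => by simp [truncDist])
    (fun x y => by simp [truncDist, edist_comm])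
    (fun x y z => by
      rw [← ENNReal.ofReal_le_ofReal_iff (add_nonneg (truncDist_nonneg _ _ _)
        (truncDist_nonneg _ _ _)), ENNReal.ofReal_add (truncDist_nonneg _ _ _)
        (truncDist_nonneg _ _ _), ofReal_truncDist, ofReal_truncDist, ofReal_truncDist]
      rcases le_total (edist x y) (ENNReal.ofReal M) with h1 | h1
      · rcases le_total (edist y z) (ENNReal.ofReal M) with h2 | h2
        · rw [min_eq_left h1, min_eq_left h2]
          exact (min_le_left _ _).trans (edist_triangle _ _ _)
        · rw [min_eq_right h2]
          exact (min_le_right _ _).trans le_add_self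
      · rw [min_eq_right h1]
        exact (min_le_right _ _).trans le_self_add)
    (fun s => by
      rw [EMetric.isOpen_iff]
      refine forall₂_congr fun x _ => ⟨?_, ?_⟩
      · rintro ⟨ε, hε, h⟩
        have hpos : 0 < min ε (ENNReal.ofReal M) := lt_min hε (ENNReal.ofReal_pos.2 hM)
        have htop : min ε (ENNReal.ofReal M) ≠ ⊤ := (min_lt_of_right_lt ENNReal.ofReal_lt_top).ne
        refine ⟨(min ε (ENNReal.ofReal M)).toReal, ENNReal.toReal_pos hpos.ne' htop,
          fun y hy => h ?_⟩
        rw [truncDist_lt_iff (ENNReal.toReal_le_of_le_ofReal hM.le (min_le_right _ _)),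
          ENNReal.ofReal_toReal htop] at hy
        rw [Metric.mem_eball, edist_comm]
        exact hy.trans_le (min_le_left _ _)
      · rintro ⟨ε, hε, h⟩
        refine ⟨ENNReal.ofReal (min ε M), ENNReal.ofReal_pos.2 (lt_min hε hM), fun y hy => h y ?_⟩
        rw [Metric.mem_eball, edist_comm, ← truncDist_lt_iff (min_le_right _ _)] at hy
        exact hy.trans_le (min_le_left _ _))
    (fun x y h => by
      have h0 : min (edist x y) (ENNReal.ofReal M) = 0 := by
        rw [← ofReal_truncDist, h, ENNReal.ofReal_zero]
      rcases min_eq_bot.1 h0 with h1 | h1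
      · exact edist_eq_zero.1 h1
      · exact absurd h1 (ENNReal.ofReal_pos.2 hM).ne')

end Truncation

/-! ### Geodesics -/

section Geodesics

/-- In a compact metric space in which points at distance less than `r` have midpoints, such
points are joined by geodesics. -/
theorem exists_geodesic_of_midpoints {X : Type*} [MetricSpace X] [CompactSpace X] {r : ℝ}
    (mid : ∀ a b : X, dist a b < r → ∃ w, dist a w = dist a b / 2 ∧ dist w b = dist a b / 2)
    {a b : X} (hab : dist a b < r) :
    ∃ c : ℝ → X, c 0 = a ∧ c (dist a b) = b ∧
      ∀ s ∈ Icc 0 (dist a b), ∀ t ∈ Icc 0 (dist a b), dist (c s) (c t) = |s - t| := by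
  -- These are the sets on which the distance from `a` is an isometry into `[0, dist a b]`. A
  -- maximal one is closed, and it fills the interval because the midpoint of the ends of a gap
  -- could be added.
  let P : Set (Set X) := {S | (∀ x ∈ S, ∀ y ∈ S, dist x y = |dist a x - dist a y|) ∧
    ∀ x ∈ S, dist a x ≤ dist a b}
  have h0 : {a, b} ∈ P := by
    refine ⟨?_, ?_⟩
    · rintro x (rfl | rfl) y (rfl | rfl) <;> simp [dist_comm]
    · rintro x (rfl | rfl) <;> simp
  obtain ⟨S, hS, hmax⟩ := zorn_subset_nonempty P (fun C hC hchain _ => by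
    refine ⟨⋃₀ C, ⟨?_, ?_⟩, fun s hs => subset_sUnion_of_mem hs⟩
    · rintro x ⟨s, hs, hx⟩ y ⟨t, ht, hy⟩
      rcases hchain.total hs ht with hst | hst
      · exact (hC ht).1 x (hst hx) y hy
      · exact (hC hs).1 x hx y (hst hy)
    · rintro x ⟨s, hs, hx⟩
      exact (hC hs).2 x hx) _ h0
  have haS : a ∈ S := hS (by simp)
  have hbS : b ∈ S := hS (by simp)
  obtain ⟨hd, hle⟩ := hmax.prop
  have hcl : IsClosed S := by
    refine closure_subset_iff_isClosed.1 (hmax.le_of_ge ⟨?_, ?_⟩ subset_closure)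
    · have hC : IsClosed {q : X × X | dist q.1 q.2 = |dist a q.1 - dist a q.2|} :=
        isClosed_eq (by fun_prop) (by fun_prop)
      have hsub : closure (S ×ˢ S) ⊆ {q : X × X | dist q.1 q.2 = |dist a q.1 - dist a q.2|} :=
        hC.closure_subset_iff.2 fun q hq => hd q.1 hq.1 q.2 hq.2
      rw [closure_prod_eq] at hsub
      exact fun x hx y hy => hsub (mk_mem_prod hx hy)
    · have hC : IsClosed {x : X | dist a x ≤ dist a b} :=
        isClosed_le (by fun_prop) continuous_const
      exact fun x hx => hC.closure_subset_iff.2 hle hx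
  have hsurj : ∀ s ∈ Icc 0 (dist a b), ∃ x ∈ S, dist a x = s := by
    intro s hs
    by_contra! hne
    have hcont : Continuous fun x => dist a x := by fun_prop
    -- The points `x` and `y` are the ends of the gap of `S` around `s`.
    obtain ⟨x, ⟨hxS, hxs⟩, hx⟩ := (hcl.inter
      (isClosed_le hcont continuous_const)).isCompact.exists_isMaxOn
      (s := S ∩ {x | dist a x ≤ s}) ⟨a, haS, by simpa using hs.1⟩ hcont.continuousOn
    obtain ⟨y, ⟨hyS, hys⟩, hy⟩ := (hcl.inter
      (isClosed_le continuous_const hcont)).isCompact.exists_isMinOn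
      (s := S ∩ {x | s ≤ dist a x}) ⟨b, hbS, hs.2⟩ hcont.continuousOn
    have hxs' : dist a x < s := lt_of_le_of_ne hxs (hne x hxS)
    have hys' : s < dist a y := lt_of_le_of_ne hys (hne y hyS).symm
    have hxy : dist x y = dist a y - dist a x := by
      rw [hd x hxS y hyS, abs_sub_comm, abs_of_pos (by linarith)]
    obtain ⟨w, hw1, hw2⟩ := mid x y (by linarith [hle y hyS, dist_nonneg (x := a) (y := x)])
    -- The triangle inequality through `x` bounds the distance above, the one towards `y` bounds it
    -- below, and the bounds coincide because `w` is the midpoint.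
    have hlow : ∀ u ∈ S, dist a u ≤ dist a x →
        dist u w = (dist a x + dist a y) / 2 - dist a u := fun u hu hux => by
      have h1 := hd u hu x hxS
      have h2 := hd u hu y hyS
      rw [abs_sub_comm, abs_of_nonneg (by linarith)] at h1 h2
      linarith [dist_triangle u x w, dist_triangle u w y]
    have haw : dist a w = (dist a x + dist a y) / 2 := by
      simpa using hlow a haS (by simp)
    have hhigh : ∀ u ∈ S, dist a y ≤ dist a u →
        dist u w = dist a u - (dist a x + dist a y) / 2 := fun u hu hyu => by
      have h1 := hd u hu x hxS
      have h2 := hd u hu y hyS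
      rw [abs_of_nonneg (by linarith)] at h1 h2
      have h3 := dist_comm w y
      have h4 := dist_comm w x
      linarith [dist_triangle u y w, dist_triangle u w x]
    have hw : ∀ u ∈ S, dist u w = |dist a u - dist a w| := fun u hu => by
      rcases le_total (dist a u) s with hus | hus
      · have hux : dist a u ≤ dist a x := hx ⟨hu, hus⟩
        rw [hlow u hu hux, haw, abs_sub_comm, abs_of_nonneg (by linarith)]
      · have hyu : dist a y ≤ dist a u := hy ⟨hu, hus⟩
        rw [hhigh u hu hyu, haw, abs_of_nonneg (by linarith)]
    have hmem : insert w S ∈ P := by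
      refine ⟨?_, ?_⟩
      · rintro u (rfl | hu) v (rfl | hv)
        · simp
        · rw [dist_comm, hw v hv, abs_sub_comm]
        · exact hw u hu
        · exact hd u hu v hv
      · rintro u (rfl | hu)
        · linarith [hle y hyS]
        · exact hle u hu
    have hwS : w ∈ S := hmax.le_of_ge hmem (subset_insert _ _) (mem_insert _ _)
    rcases le_total (dist a w) s with hws | hws
    · have : dist a w ≤ dist a x := hx ⟨hwS, hws⟩
      linarith
    · have : dist a y ≤ dist a w := hy ⟨hwS, hws⟩
      linarith
  have : Nonempty X := ⟨a⟩
  choose! c hcS hc using hsurj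
  have huniq : ∀ x ∈ S, ∀ y ∈ S, dist a x = dist a y → x = y := fun x hx y hy h => by
    rw [← dist_eq_zero, hd x hx y hy, h, sub_self, abs_zero]
  have h0m : (0 : ℝ) ∈ Icc 0 (dist a b) := ⟨le_rfl, dist_nonneg⟩
  have h1m : dist a b ∈ Icc 0 (dist a b) := ⟨dist_nonneg, le_rfl⟩
  refine ⟨c, huniq _ (hcS 0 h0m) a haS (by rw [hc 0 h0m, dist_self]),
    huniq _ (hcS _ h1m) b hbS (hc _ h1m), fun s hs t ht => ?_⟩
  rw [hd _ (hcS s hs) _ (hcS t ht), hc s hs, hc t ht]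

/-! ### Midpoints and geodesics in compact length spaces -/

variable {G : Type*} [EMetricSpace G]

theorem edist_add_edist_le_pathLength {x y : G} (γ : Path x y) (s : unitInterval) :
    edist x (γ s) + edist (γ s) y ≤ pathLength γ := by
  have h1 : edist x (γ s) ≤ eVariationOn γ (Iic s) := by
    have := eVariationOn.edist_le γ (s := Iic s) (x := 0) (y := s) (mem_Iic.2 unitInterval.nonneg')
      (mem_Iic.2 le_rfl)
    rwa [γ.source] at this
  have h2 : edist (γ s) y ≤ eVariationOn γ (Ici s) := by
    have := eVariationOn.edist_le γ (s := Ici s) (x := s) (y := 1) (mem_Ici.2 le_rfl)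
      (mem_Ici.2 unitInterval.le_one')
    rwa [γ.target] at this
  exact (add_le_add h1 h2).trans ((eVariationOn.add_le_union γ fun _ hx _ hy => hx.trans hy).trans
    (eVariationOn.mono γ (subset_univ _)))

/-- On a nearly shortest path, the intermediate value theorem gives a point at exactly half the
distance from `a` and at almost half from `b`; compactness removes the error. -/
theorem IsLengthMetric.exists_midpoint [CompactSpace G] (hG : IsLengthMetric G) {a b : G}
    (hab : edist a b ≠ ⊤) : ∃ z, edist a z = edist a b / 2 ∧ edist z b = edist a b / 2 := by
  have hfin : edist a b / 2 ≠ ⊤ := ENNReal.div_ne_top hab (by norm_num)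
  have happ : ∀ ε : ℝ≥0∞, 0 < ε → ∃ z, edist a z = edist a b / 2 ∧
      edist z b ≤ edist a b / 2 + ε := by
    intro ε hε
    obtain ⟨γ, hγ⟩ : ∃ γ : Path a b, pathLength γ < edist a b + ε := by
      rw [← iInf_lt_iff, ← hG a b]
      exact ENNReal.lt_add_right hab hε.ne'
    have hcont : Continuous fun s => edist a (γ s) := continuous_const.edist γ.continuous
    obtain ⟨s, hs⟩ := mem_range_of_exists_le_of_exists_ge hcont
      (c := edist a b / 2) ⟨0, by simp⟩ ⟨1, by simpa using ENNReal.half_le_self⟩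
    replace hs : edist a (γ s) = edist a b / 2 := hs
    refine ⟨γ s, hs, ?_⟩
    have h := (edist_add_edist_le_pathLength γ s).trans hγ.le
    rw [hs, ← ENNReal.add_halves (edist a b), add_assoc, ENNReal.add_halves] at h
    exact (ENNReal.add_le_add_iff_left hfin).1 h
  have hcont : Continuous fun z => edist a z := continuous_const.edist continuous_id
  obtain ⟨z₁, hz₁, -⟩ := happ 1 one_pos
  obtain ⟨z, hz, hmin⟩ := (isClosed_eq hcont
    (continuous_const (y := edist a b / 2))).isCompact.exists_isMinOn ⟨z₁, hz₁⟩
    (continuous_id.edist (continuous_const (y := b))).continuousOn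
  have hz' : edist a z = edist a b / 2 := hz
  refine ⟨z, hz', le_antisymm ?_ ?_⟩
  · refine ENNReal.le_of_forall_pos_le_add fun ε hε _ => ?_
    obtain ⟨w, hw, hwb⟩ := happ ε (by exact_mod_cast hε)
    exact (hmin hw : edist z b ≤ edist w b).trans hwb
  · have h := edist_triangle a z b
    rw [hz'] at h
    nth_rw 1 [← ENNReal.add_halves (edist a b)] at h
    exact (ENNReal.add_le_add_iff_left hfin).1 h

theorem IsLengthMetric.truncMetric_midpoint [CompactSpace G] (hG : IsLengthMetric G) {M : ℝ}
    {a b : G} (hab : truncDist M a b < M) :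
    ∃ w, truncDist M a w = truncDist M a b / 2 ∧ truncDist M w b = truncDist M a b / 2 := by
  have he := edist_eq_of_truncDist_lt hab
  have h0 := truncDist_nonneg M a b
  obtain ⟨w, h1, h2⟩ := hG.exists_midpoint (by rw [he]; exact ENNReal.ofReal_ne_top)
  have key : edist a b / 2 = ENNReal.ofReal (truncDist M a b / 2) := by
    rw [he, ENNReal.ofReal_div_of_pos two_pos, ENNReal.ofReal_ofNat]
  have hval : ∀ x y : G, edist x y = ENNReal.ofReal (truncDist M a b / 2) →
      truncDist M x y = truncDist M a b / 2 := fun x y h => by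
    rw [truncDist, h, min_eq_left (ENNReal.ofReal_le_ofReal (by linarith)),
      ENNReal.toReal_ofReal (by linarith)]
  exact ⟨w, hval _ _ (h1.trans key), hval _ _ (h2.trans key)⟩

/-- Points at finite distance in a compact length space are joined by a geodesic. -/
theorem IsLengthMetric.exists_geodesic [CompactSpace G] (hG : IsLengthMetric G) {a b : G}
    (hab : edist a b ≠ ⊤) : ∃ c : ℝ → G, c 0 = a ∧ c (edist a b).toReal = b ∧
      ∀ s ∈ Icc 0 (edist a b).toReal, ∀ t ∈ Icc 0 (edist a b).toReal,
        edist (c s) (c t) = ENNReal.ofReal |s - t| := by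
  have h0 : 0 ≤ (edist a b).toReal := ENNReal.toReal_nonneg
  -- Truncating above the distance from `a` to `b` leaves all distances along the geodesic intact.
  set M := (edist a b).toReal + 1 with hM
  have hlt : truncDist M a b < M := by
    rw [truncDist_lt_iff le_rfl, ENNReal.lt_ofReal_iff_toReal_lt hab]
    linarith
  have hD : truncDist M a b = (edist a b).toReal := by
    rw [edist_eq_of_truncDist_lt hlt, ENNReal.toReal_ofReal (truncDist_nonneg _ _ _)]
  obtain ⟨c, h1, h2, h3⟩ := @exists_geodesic_of_midpoints G
    (truncMetric G (by linarith : 0 < M)) _ M (fun a b h => hG.truncMetric_midpoint h) a b hlt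
  change c (truncDist M a b) = b at h2
  change ∀ s ∈ Icc 0 (truncDist M a b), ∀ t ∈ Icc 0 (truncDist M a b),
    truncDist M (c s) (c t) = |s - t| at h3
  rw [hD] at h2 h3
  refine ⟨c, h1, h2, fun s hs t ht => ?_⟩
  rw [edist_eq_of_truncDist_lt (M := M), h3 s hs t ht]
  rw [h3 s hs t ht]
  exact (abs_sub_le_of_nonneg_of_le hs.1 hs.2 ht.1 ht.2).trans_lt (by linarith)

end Geodesics

/-! ### Arcs and simple cycles -/

section Concatenation

variable {G : Type*}

/-- The concatenation of two curves, the first one being of length `L`. -/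
def concat (c₁ : ℝ → G) (L : ℝ) (c₂ : ℝ → G) (t : ℝ) : G := if t ≤ L then c₁ t else c₂ (t - L)

variable {c₁ c₂ : ℝ → G} {L₁ L₂ : ℝ}

theorem concat_of_le {t : ℝ} (h : t ≤ L₁) : concat c₁ L₁ c₂ t = c₁ t := if_pos h

theorem concat_of_lt {t : ℝ} (h : L₁ < t) : concat c₁ L₁ c₂ t = c₂ (t - L₁) := if_neg h.not_ge

theorem concat_add (h : c₁ L₁ = c₂ 0) {t : ℝ} (ht : 0 ≤ t) :
    concat c₁ L₁ c₂ (L₁ + t) = c₂ t := by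
  rcases ht.eq_or_lt with rfl | ht
  · rw [add_zero, concat_of_le le_rfl, h]
  · rw [concat_of_lt (by linarith), add_sub_cancel_left]

theorem injOn_concat {J : Set ℝ} (hJ : ∀ t ∈ J, 0 < t) (h₁ : InjOn c₁ (Icc 0 L₁))
    (h₂ : InjOn c₂ J) (h : ∀ s ∈ Icc 0 L₁, ∀ t ∈ J, c₁ s ≠ c₂ t) :
    InjOn (concat c₁ L₁ c₂) {t | t ∈ Icc 0 L₁ ∨ t - L₁ ∈ J} := by
  rintro s (hs | hs) t (ht | ht) hst
  · rw [concat_of_le hs.2, concat_of_le ht.2] at hst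
    exact h₁ hs ht hst
  · rw [concat_of_le hs.2, concat_of_lt (by linarith [hJ _ ht])] at hst
    exact absurd hst (h s hs _ ht)
  · rw [concat_of_le ht.2, concat_of_lt (by linarith [hJ _ hs])] at hst
    exact absurd hst.symm (h t ht _ hs)
  · rw [concat_of_lt (by linarith [hJ _ hs]), concat_of_lt (by linarith [hJ _ ht])] at hst
    linarith [h₂ hs ht hst]

end Concatenation

/-! ### Arcs, closed curves and bounds for the systole -/

section Arcs

variable {G : Type*} [EMetricSpace G]

/-- A `1`-Lipschitz curve on `[0, L]`. -/
def IsShortCurve (c : ℝ → G) (L : ℝ) : Prop :=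
  ∀ s ∈ Icc 0 L, ∀ t ∈ Icc 0 L, edist (c s) (c t) ≤ ENNReal.ofReal |s - t|

/-- An injective `1`-Lipschitz curve on `[0, L]`. -/
structure IsArc (c : ℝ → G) (L : ℝ) : Prop where
  nonneg : 0 ≤ L
  short : IsShortCurve c L
  injOn : InjOn c (Icc 0 L)

theorem IsShortCurve.continuousOn {c : ℝ → G} {L : ℝ} (h : IsShortCurve c L) :
    ContinuousOn c (Icc 0 L) := by
  refine LipschitzOnWith.continuousOn (K := 1) fun s hs t ht => ?_
  rw [ENNReal.coe_one, one_mul, edist_dist, Real.dist_eq]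
  exact h s hs t ht

theorem IsArc.shift {c : ℝ → G} {L u v : ℝ} (h : IsArc c L) (hu : 0 ≤ u) (huv : u ≤ v)
    (hv : v ≤ L) : IsArc (fun t => c (u + t)) (v - u) := by
  have hm : ∀ t ∈ Icc 0 (v - u), u + t ∈ Icc 0 L := fun t ht =>
    ⟨by linarith [ht.1], by linarith [ht.2]⟩
  refine ⟨by linarith, fun s hs t ht => ?_, fun s hs t ht hst => ?_⟩
  · simpa using h.short _ (hm s hs) _ (hm t ht)
  · simpa using h.injOn (hm s hs) (hm t ht) hst

theorem isArc_of_isometry {c : ℝ → G} {L : ℝ} (hL : 0 ≤ L)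
    (h : ∀ s ∈ Icc 0 L, ∀ t ∈ Icc 0 L, edist (c s) (c t) = ENNReal.ofReal |s - t|) :
    IsArc c L := by
  refine ⟨hL, fun s hs t ht => (h s hs t ht).le, fun s hs t ht hst => ?_⟩
  have := h s hs t ht
  rw [hst, edist_self, eq_comm, ENNReal.ofReal_eq_zero] at this
  linarith [abs_nonpos_iff.1 this]

variable {c₁ c₂ : ℝ → G} {L₁ L₂ : ℝ}

theorem IsShortCurve.concat (h₁ : IsShortCurve c₁ L₁) (h₂ : IsShortCurve c₂ L₂)
    (hL₁ : 0 ≤ L₁) (hL₂ : 0 ≤ L₂) (h : c₁ L₁ = c₂ 0) :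
    IsShortCurve (concat c₁ L₁ c₂) (L₁ + L₂) := by
  have key : ∀ s ∈ Icc 0 (L₁ + L₂), ∀ t ∈ Icc 0 (L₁ + L₂), s ≤ t →
      edist (MetricGraph.concat c₁ L₁ c₂ s) (MetricGraph.concat c₁ L₁ c₂ t) ≤
        ENNReal.ofReal |s - t| := by
    intro s hs t ht hst
    rcases le_or_gt t L₁ with htL | htL
    · rw [concat_of_le htL, concat_of_le (hst.trans htL)]
      exact h₁ s ⟨hs.1, hst.trans htL⟩ t ⟨ht.1, htL⟩
    have ht' : t - L₁ ∈ Icc 0 L₂ := ⟨by linarith, by linarith [ht.2]⟩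
    rw [concat_of_lt htL]
    rcases le_or_gt s L₁ with hsL | hsL
    · rw [concat_of_le hsL]
      have e1 := h₁ s ⟨hs.1, hsL⟩ L₁ ⟨hL₁, le_rfl⟩
      have e2 := h₂ 0 ⟨le_rfl, hL₂⟩ _ ht'
      rw [abs_sub_comm, abs_of_nonneg (by linarith)] at e1
      rw [abs_sub_comm, abs_of_nonneg (by linarith)] at e2
      rw [abs_sub_comm, abs_of_nonneg (by linarith),
        show t - s = (L₁ - s) + (t - L₁ - 0) by ring,
        ENNReal.ofReal_add (by linarith) (by linarith)]
      exact (edist_triangle _ (c₁ L₁) _).trans (add_le_add e1 (h ▸ e2))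
    · rw [concat_of_lt hsL]
      simpa using h₂ (s - L₁) ⟨by linarith, by linarith [hs.2]⟩ _ ht'
  intro s hs t ht
  rcases le_total s t with hst | hst
  · exact key s hs t ht hst
  · rw [edist_comm, abs_sub_comm]
    exact key t ht s hs hst

theorem IsArc.concat (h₁ : IsArc c₁ L₁) (h₂ : IsArc c₂ L₂) (h : c₁ L₁ = c₂ 0)
    (hd : ∀ s ∈ Icc 0 L₁, ∀ t ∈ Icc 0 L₂, c₁ s = c₂ t → t = 0) :
    IsArc (concat c₁ L₁ c₂) (L₁ + L₂) := by
  refine ⟨add_nonneg h₁.nonneg h₂.nonneg, h₁.short.concat h₂.short h₁.nonneg h₂.nonneg h, ?_⟩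
  refine (injOn_concat (J := Ioc 0 L₂) (fun t ht => ht.1) h₁.injOn
    (h₂.injOn.mono Ioc_subset_Icc_self)
    fun s hs t ht hst => ht.1.ne' (hd s hs t ⟨ht.1.le, ht.2⟩ hst)).mono fun t ht => ?_
  rcases le_or_gt t L₁ with htL | htL
  · exact Or.inl ⟨ht.1, htL⟩
  · exact Or.inr ⟨by linarith, by linarith [ht.2]⟩

/-- A closed short curve that is injective apart from its endpoints bounds the systole. -/
theorem systole_le_of_closed {c : ℝ → G} {L : ℝ} (hL : 0 < L) (hc : IsShortCurve c L)
    (hinj : InjOn c (Ico 0 L)) (h : c 0 = c L) : systole G ≤ ENNReal.ofReal L := by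
  have hm : ∀ s : unitInterval, L * s ∈ Icc 0 L := fun s =>
    ⟨mul_nonneg hL.le s.2.1, mul_le_of_le_one_right hL.le s.2.2⟩
  let γ : Path (c 0) (c 0) :=
    { toFun := fun s => c (L * s)
      continuous_toFun := hc.continuousOn.comp_continuous (by fun_prop) hm
      source' := by simp
      target' := by simp [h] }
  have hγ : ∀ s, γ s = c (L * s) := fun _ => rfl
  have hsimple : IsSimpleCycle γ := by
    have hlt : ∀ s : unitInterval, s ≠ 1 → L * s ∈ Ico 0 L := fun s hs =>
      ⟨(hm s).1, mul_lt_of_lt_one_right hL (unitInterval.lt_one_iff_ne_one.2 hs)⟩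
    have hinj' : ∀ s t : unitInterval, s ≠ 1 → t ≠ 1 → γ s = γ t → s = t := fun s t hs ht hst =>
      Subtype.ext (mul_left_cancel₀ hL.ne' (hinj (hlt s hs) (hlt t ht) hst))
    have h1 : ∀ t : unitInterval, t ≠ 1 → γ 1 = γ t → t = 0 := fun t ht h1t =>
      hinj' t 0 ht (by simp) (by rw [← h1t, γ.source, γ.target])
    intro s t hst
    by_cases hs : s = 1 <;> by_cases ht : t = 1
    · exact Or.inl (hs.trans ht.symm)
    · exact Or.inr (Or.inr ⟨hs, h1 t ht (hs ▸ hst)⟩)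
    · exact Or.inr (Or.inl ⟨h1 s hs (ht ▸ hst.symm), ht⟩)
    · exact Or.inl (hinj' s t hs ht hst)
  have hlen : pathLength γ ≤ ENNReal.ofReal L := by
    have hlip : LipschitzOnWith 1 c (Icc 0 L) := fun s hs t ht => by
      rw [ENNReal.coe_one, one_mul, edist_dist, Real.dist_eq]
      exact hc s hs t ht
    have h2 := hlip.comp_eVariationOn_le (g := fun s : unitInterval => L * (s : ℝ)) (s := univ)
      fun s _ => hm s
    rw [ENNReal.coe_one, one_mul] at h2
    refine h2.trans ?_
    have hmono : MonotoneOn (fun s : unitInterval => L * (s : ℝ)) univ := fun s _ t _ hst =>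
      mul_le_mul_of_nonneg_left hst hL.le
    have h3 := hmono.eVariationOn_eq (a := 0) (b := 1) (mem_univ _) (mem_univ _)
    have h4 : (univ : Set unitInterval) ∩ Icc 0 1 = univ := by
      rw [univ_inter]; exact eq_univ_of_forall fun s => ⟨unitInterval.nonneg', unitInterval.le_one'⟩
    rw [h4] at h3
    simpa using h3.le
  exact (iInf_le_of_le (c 0) (iInf_le_of_le γ (iInf_le_of_le hsimple le_rfl))).trans hlen

/-- Two arcs with the same endpoints, that do not meet otherwise, bound the systole. -/
theorem systole_le_of_two_arcs (h₁ : IsArc c₁ L₁) (h₂ : IsArc c₂ L₂) (hpos : 0 < L₁)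
    (h : c₁ L₁ = c₂ 0) (h' : c₂ L₂ = c₁ 0)
    (hd : ∀ s ∈ Icc 0 L₁, ∀ t ∈ Icc 0 L₂, c₁ s = c₂ t → t = 0 ∨ t = L₂) :
    systole G ≤ ENNReal.ofReal (L₁ + L₂) := by
  refine systole_le_of_closed (c := concat c₁ L₁ c₂) (by linarith [h₂.nonneg])
    (h₁.short.concat h₂.short h₁.nonneg h₂.nonneg h) ?_ ?_
  · refine (injOn_concat (J := Ioo 0 L₂) (fun t ht => ht.1) h₁.injOn
      (h₂.injOn.mono Ioo_subset_Icc_self) fun s hs t ht hst => ?_).mono fun t ht => ?_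
    · rcases hd s hs t ⟨ht.1.le, ht.2.le⟩ hst with h0 | h0
      · exact ht.1.ne' h0
      · exact ht.2.ne h0
    · rcases le_or_gt t L₁ with htL | htL
      · exact Or.inl ⟨ht.1, htL⟩
      · exact Or.inr ⟨by linarith, by linarith [ht.2]⟩
  · rw [concat_of_le h₁.nonneg, concat_add h h₂.nonneg, h']

theorem IsArc.isCompact_image {c : ℝ → G} {L u v : ℝ} (h : IsArc c L) (hu : 0 ≤ u) (hv : v ≤ L) :
    IsCompact (c '' Icc u v) :=
  isCompact_Icc.image_of_continuousOn (h.short.continuousOn.mono (Icc_subset_Icc hu hv))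

theorem IsArc.isCompact_preimage {c : ℝ → G} {L u v : ℝ} (h : IsArc c L) (hu : 0 ≤ u) (hv : v ≤ L)
    {A : Set G} (hA : IsCompact A) : IsCompact {t | t ∈ Icc u v ∧ c t ∈ A} :=
  isCompact_Icc.of_isClosed_subset
    ((h.short.continuousOn.mono (Icc_subset_Icc hu hv)).preimage_isClosed_of_isClosed
      isClosed_Icc hA.isClosed) fun _ ht => ht.1

/-- Two consecutive arcs contain an arc between their ends. -/
theorem IsArc.exists_join (h₁ : IsArc c₁ L₁) (h₂ : IsArc c₂ L₂) (h : c₁ L₁ = c₂ 0) :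
    ∃ (c : ℝ → G) (L : ℝ), IsArc c L ∧ L ≤ L₁ + L₂ ∧ c 0 = c₁ 0 ∧ c L = c₂ L₂ ∧
      c '' Icc 0 L ⊆ c₁ '' Icc 0 L₁ ∪ c₂ '' Icc 0 L₂ := by
  -- The first arc is left at the first point where it meets the second, which is then followed to
  -- its end.
  obtain ⟨s, ⟨hs, t, ht, hst⟩, hmin⟩ := (h₁.isCompact_preimage le_rfl le_rfl
    (h₂.isCompact_image le_rfl le_rfl)).exists_isLeast
    ⟨L₁, ⟨h₁.nonneg, le_rfl⟩, 0, ⟨le_rfl, h₂.nonneg⟩, h.symm⟩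
  have ha₁ := h₁.shift le_rfl hs.1 hs.2
  have ha₂ := h₂.shift ht.1 ht.2 le_rfl
  simp only [zero_add, sub_zero] at ha₁
  have hglue : c₁ s = c₂ (t + 0) := by rw [add_zero, hst]
  have harc := ha₁.concat ha₂ hglue fun s' hs' t' ht' heq => by
    have hmem : t + t' ∈ Icc 0 L₂ := ⟨by linarith [ht.1, ht'.1], by linarith [ht'.2]⟩
    have hs'' : s' = s := le_antisymm hs'.2
      (hmin ⟨⟨hs'.1, hs'.2.trans hs.2⟩, t + t', hmem, heq.symm⟩)
    rw [hs'', ← hst] at heq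
    linarith [h₂.injOn ht hmem heq]
  refine ⟨_, _, harc, by linarith [hs.2, ht.1], concat_of_le hs.1, ?_, ?_⟩
  · rw [concat_add hglue ha₂.nonneg, add_sub_cancel]
  · rintro _ ⟨u, hu, rfl⟩
    rcases le_or_gt u s with hus | hus
    · rw [concat_of_le hus]
      exact Or.inl ⟨u, ⟨hu.1, hus.trans hs.2⟩, rfl⟩
    · rw [concat_of_lt hus]
      exact Or.inr ⟨_, ⟨by linarith [ht.1], by linarith [hu.2]⟩, rfl⟩

/-- An arc from `a` to `b` and an arc from `b` to `a` that avoids some interior point of the first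
one bound the systole. -/
theorem systole_le_of_avoiding (h₁ : IsArc c₁ L₁) (h₂ : IsArc c₂ L₂) (h : c₁ L₁ = c₂ 0)
    (h' : c₂ L₂ = c₁ 0) {τ : ℝ} (hτ : τ ∈ Icc 0 L₁) (hav : ∀ t ∈ Icc 0 L₂, c₂ t ≠ c₁ τ) :
    systole G ≤ ENNReal.ofReal (L₁ + L₂) := by
  -- Here `s` is the last time that `c₂` is on the part of `c₁` from `τ` on, and `t` below is the
  -- first later time on the part up to `τ`. In between, `c₂` meets `c₁` only at the ends, and the
  -- stretch of `c₁` from `v` to `u` closes it up.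
  obtain ⟨s, ⟨hs, u, hu, hus⟩, hmax⟩ := (h₂.isCompact_preimage le_rfl le_rfl
    (h₁.isCompact_image hτ.1 le_rfl)).exists_isGreatest
    ⟨0, ⟨le_rfl, h₂.nonneg⟩, L₁, ⟨hτ.2, le_rfl⟩, h⟩
  obtain ⟨t, ⟨ht, v, hv, hvt⟩, hmin⟩ := (h₂.isCompact_preimage hs.1 le_rfl
    (h₁.isCompact_image le_rfl hτ.2)).exists_isLeast
    ⟨L₂, ⟨hs.2, le_rfl⟩, 0, ⟨le_rfl, hτ.1⟩, h'.symm⟩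
  have huτ : τ < u := lt_of_le_of_ne hu.1 fun he => hav s hs (by rw [he, hus])
  have hvu : v < u := hv.2.trans_lt huτ
  have ha₁ := h₁.shift hv.1 hvu.le hu.2
  have ha₂ := h₂.shift hs.1 ht.1 ht.2
  refine (systole_le_of_two_arcs ha₁ ha₂ (by linarith) ?_ ?_ ?_).trans
    (ENNReal.ofReal_le_ofReal (by linarith [hu.2, hv.1, ht.2, hs.1]))
  · rw [add_sub_cancel, add_zero, hus]
  · rw [add_sub_cancel, add_zero, hvt]
  · intro x hx y hy hxy
    have hxm : v + x ∈ Icc 0 L₁ := ⟨by linarith [hv.1, hx.1], by linarith [hx.2, hu.2]⟩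
    have hym : s + y ∈ Icc 0 L₂ := ⟨by linarith [hs.1, hy.1], by linarith [hy.2, ht.2]⟩
    rcases le_total τ (v + x) with hle | hle
    · have := hmax ⟨hym, v + x, ⟨hle, hxm.2⟩, hxy⟩
      exact Or.inl (by linarith [hy.1])
    · have := hmin ⟨⟨by linarith [hy.1], hym.2⟩, v + x, ⟨hxm.1, hle⟩, hxy⟩
      exact Or.inr (by linarith [hy.2])

end Arcs

/-! ### The tripod property -/

section Tripod

variable {G : Type*} [EMetricSpace G]

theorem IsLengthMetric.exists_geodesic_arc [CompactSpace G] (hG : IsLengthMetric G) {a b : G}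
    (hab : edist a b ≠ ⊤) : ∃ c : ℝ → G, IsArc c (edist a b).toReal ∧ c 0 = a ∧
      c (edist a b).toReal = b ∧ ∀ s ∈ Icc 0 (edist a b).toReal,
        edist a (c s) + edist (c s) b = edist a b := by
  obtain ⟨c, h0, h1, hc⟩ := hG.exists_geodesic hab
  refine ⟨c, isArc_of_isometry ENNReal.toReal_nonneg hc, h0, h1, fun s hs => ?_⟩
  have e1 := hc 0 ⟨le_rfl, ENNReal.toReal_nonneg⟩ s hs
  have e2 := hc s hs _ ⟨ENNReal.toReal_nonneg, le_rfl⟩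
  rw [h0, zero_sub, abs_neg, abs_of_nonneg hs.1] at e1
  rw [h1, abs_sub_comm, abs_of_nonneg (by linarith [hs.2])] at e2
  rw [e1, e2, ← ENNReal.ofReal_add hs.1 (by linarith [hs.2]), add_sub_cancel,
    ENNReal.ofReal_toReal hab]

/-- In a compact length space, a geodesic triangle whose perimeter is less than the systole is a
tripod: each point of a side lies on a geodesic from the opposite vertex to an end of that side. -/
theorem IsLengthMetric.tripod [CompactSpace G] (hG : IsLengthMetric G) {a b p z : G}
    (hper : edist a b + edist b p + edist p a < systole G)
    (hz : edist a z + edist z b = edist a b) :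
    edist p z + edist z a = edist p a ∨ edist p z + edist z b = edist p b := by
  by_contra! hne
  obtain ⟨hne₁, hne₂⟩ := hne
  have hfin := hper.trans_le le_top
  have hab : edist a b ≠ ⊤ :=
    (lt_of_le_of_lt (le_self_add.trans le_self_add) hfin).ne
  have hbp : edist b p ≠ ⊤ := (lt_of_le_of_lt (le_add_self.trans le_self_add) hfin).ne
  have hpa : edist p a ≠ ⊤ := (lt_of_le_of_lt le_add_self hfin).ne
  have haz : edist a z ≠ ⊤ := fun h => hab (by rw [← hz, h, top_add])
  have hzb : edist z b ≠ ⊤ := fun h => hab (by rw [← hz, h, add_top])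
  obtain ⟨c₁, hc₁, h10, h11, hg₁⟩ := hG.exists_geodesic_arc haz
  obtain ⟨c₂, hc₂, h20, h21, hg₂⟩ := hG.exists_geodesic_arc hzb
  obtain ⟨c₃, hc₃, h30, h31, hg₃⟩ := hG.exists_geodesic_arc hbp
  obtain ⟨c₄, hc₄, h40, h41, hg₄⟩ := hG.exists_geodesic_arc hpa
  have h12 := h11.trans h20.symm
  -- A point `w` common to both halves of the side would shorten it by twice its distance to `z`, so
  -- `w = z`.
  have hα := hc₁.concat hc₂ h12 fun s hs t ht hst => by
    have e1 := hg₁ s hs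
    have e2 := hg₂ t ht
    rw [← hst] at e2
    set w := c₁ s
    have hwz : edist w z ≠ ⊤ := fun h => haz (by rw [← e1, h, add_top])
    have hzw : edist w z + edist w z = 0 := by
      have hle : edist a b + (edist w z + edist w z) ≤ edist a b + 0 := by
        calc edist a b + (edist w z + edist w z)
            ≤ (edist a w + edist w b) + (edist w z + edist w z) := by
              gcongr; exact edist_triangle _ _ _
          _ = (edist a w + edist w z) + (edist z w + edist w b) := by
              rw [edist_comm z w]; ring
          _ = edist a b + 0 := by rw [e1, e2, hz, add_zero]
      exact le_antisymm ((ENNReal.add_le_add_iff_left hab).1 hle) bot_le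
    have hw : w = z := edist_eq_zero.1 (add_eq_zero.1 hzw).1
    refine hc₂.injOn ht ⟨le_rfl, hc₂.nonneg⟩ ?_
    rw [← hst, h20, hw]
  -- The other two sides contain an arc from `b` to `a`. It misses `z`, since a passage through `z`
  -- would put `z` on a geodesic from `p`.
  obtain ⟨c, L, hc, hL, hcb, hca, hsub⟩ := hc₃.exists_join hc₄ (h31.trans h40.symm)
  have hτ : (edist a z).toReal ∈ Icc 0 ((edist a z).toReal + (edist z b).toReal) :=
    ⟨hc₁.nonneg, by linarith [hc₂.nonneg]⟩
  have hsys := systole_le_of_avoiding hα hc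
    (by rw [concat_add h12 hc₂.nonneg, h21, hcb, h30])
    (by rw [concat_of_le hc₁.nonneg, hca, h41, h10]) hτ (fun t ht heq => by
      rw [concat_of_le le_rfl, h11] at heq
      rcases hsub ⟨t, ht, rfl⟩ with ⟨s, hs, hst⟩ | ⟨s, hs, hst⟩
      · have := hg₃ s hs
        rw [hst, heq] at this
        exact hne₂ (by rw [edist_comm p z, edist_comm z b, edist_comm p b, ← this, add_comm])
      · have := hg₄ s hs
        rw [hst, heq] at this
        exact hne₁ this)
  refine (hsys.trans ?_).not_gt hper
  rw [← ENNReal.ofReal_toReal hfin.ne, ENNReal.toReal_add (ENNReal.add_ne_top.2 ⟨hab, hbp⟩) hpa,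
    ENNReal.toReal_add hab hbp]
  refine ENNReal.ofReal_le_ofReal ?_
  rw [← ENNReal.toReal_add haz hzb, hz]
  linarith

end Tripod

/-! ### Short geodesics from the tripod property -/

section TripodSpace

/-- Points at distance less than `r` have midpoints, and geodesic triangles with sides shorter
than `r` are tripods. -/
structure IsTripodal (X : Type*) [MetricSpace X] (r : ℝ) : Prop where
  midpoint : ∀ a b : X, dist a b < r →
    ∃ w, dist a w = dist a b / 2 ∧ dist w b = dist a b / 2
  tripod : ∀ a b p z : X, dist a b < r → dist b p < r → dist p a < r →
    dist a z + dist z b = dist a b →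
    dist p z + dist z a = dist p a ∨ dist p z + dist z b = dist p b

namespace IsTripodal

variable {X : Type*} [MetricSpace X] {r : ℝ}

theorem exists_between [CompactSpace X] (h : IsTripodal X r) {a b : X} {t : ℝ} (hab : dist a b < r)
    (ht : t ∈ Icc (0 : ℝ) 1) :
    ∃ z, dist a z = t * dist a b ∧ dist z b = (1 - t) * dist a b := by
  obtain ⟨c, h0, h1, hc⟩ := exists_geodesic_of_midpoints h.midpoint hab
  have hd := dist_nonneg (x := a) (y := b)
  have hm : t * dist a b ∈ Icc 0 (dist a b) :=
    ⟨mul_nonneg ht.1 hd, mul_le_of_le_one_left hd ht.2⟩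
  have e1 := hc 0 ⟨le_rfl, hd⟩ _ hm
  have e2 := hc _ hm _ ⟨hd, le_rfl⟩
  rw [h0, zero_sub, abs_neg, abs_of_nonneg hm.1] at e1
  rw [h1, abs_sub_comm, abs_of_nonneg (by linarith [hm.2])] at e2
  exact ⟨_, e1, by rw [e2]; ring⟩

/-- A point on a geodesic is determined by its distances to the ends. -/
theorem eq_of_dist (h : IsTripodal X r) {a b z z' : X} {t : ℝ} (hab : dist a b < r)
    (ht : t ∈ Icc (0 : ℝ) 1) (hz : dist a z = t * dist a b) (hz' : dist z b = (1 - t) * dist a b)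
    (hw : dist a z' = t * dist a b) (hw' : dist z' b = (1 - t) * dist a b) : z = z' := by
  have hd := dist_nonneg (x := a) (y := b)
  have h1 := mul_le_of_le_one_left hd ht.2
  have h2 : (1 - t) * dist a b ≤ dist a b := mul_le_of_le_one_left hd (by linarith [ht.1])
  have e1 := dist_comm b z'
  have e2 := dist_comm z' a
  have e3 := dist_comm z a
  rw [← dist_eq_zero, dist_comm]
  -- With `z'` as third vertex, `z` lies between `z'` and one end; both are equally far from that
  -- end, so their distance is 0.
  rcases h.tripod a b z' z hab (by linarith) (by linarith) (by rw [hz, hz']; ring) with h3 | h3 <;>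
    linarith

/-- The tripod with vertex `q` puts `z` between `q` and one of the ends, hence no farther from `q`
than that end. -/
theorem dist_lt_of_between (h : IsTripodal X r) {a b q z : X} {c : ℝ} (hc : c ≤ r)
    (hab : dist a b < r) (hz : dist a z + dist z b = dist a b) (ha : dist q a < c)
    (hb : dist q b < c) : dist q z < c := by
  have e := dist_comm b q
  have h1 := dist_nonneg (x := z) (y := a)
  have h2 := dist_nonneg (x := z) (y := b)
  rcases h.tripod a b q z hab (by linarith) (by linarith) hz with h3 | h3 <;> linarith

open Classical in
/-- The geodesics of a compact tripodal space. -/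
def shortGeodesics [CompactSpace X] (h : IsTripodal X r) : ShortGeodesics X r :=
  let geo : X → X → ℝ → X := fun a b t =>
    if H : dist a b < r ∧ t ∈ Icc (0 : ℝ) 1 then (h.exists_between H.1 H.2).choose else a
  have hgeo : ∀ a b t, dist a b < r → t ∈ Icc (0 : ℝ) 1 →
      dist a (geo a b t) = t * dist a b ∧ dist (geo a b t) b = (1 - t) * dist a b :=
    fun a b t hab ht => by
      simp only [geo, dif_pos (And.intro hab ht)]
      exact (h.exists_between hab ht).choose_spec
  { geo := geo
    geo_zero := fun a b => by
      by_cases hab : dist a b < r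
      · have := (hgeo a b 0 hab ⟨le_rfl, zero_le_one⟩).1
        rw [zero_mul] at this
        exact (dist_eq_zero.1 this).symm
      · simp [geo, hab]
    dist_geo_right := fun a b t hab ht => (hgeo a b t hab ht).2.le
    dist_geo_lt := fun a b t q c hab ht hc ha hb => by
      obtain ⟨h1, h2⟩ := hgeo a b t hab ht
      exact h.dist_lt_of_between hc hab (by rw [h1, h2]; ring) ha hb
    continuousOn_geo := by
      rintro ⟨a, b, t⟩ ⟨hab, ht⟩
      -- By compactness the geodesic points converge along each ultrafilter; the distances to the
      -- ends pass to the limit and determine it.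
      refine (Filter.tendsto_iff_ultrafilter _ _ _).2 fun U hU => ?_
      obtain ⟨hU1, hU2⟩ := le_inf_iff.1 hU
      have hev := Filter.le_principal_iff.1 hU2
      let V := U.map fun q : X × X × ℝ => geo q.1 q.2.1 q.2.2
      have hV : Filter.Tendsto (fun q : X × X × ℝ => geo q.1 q.2.1 q.2.2) U (𝓝 V.lim) :=
        V.le_nhds_lim
      have ha : Filter.Tendsto (fun q : X × X × ℝ => q.1) U (𝓝 a) :=
        (continuous_fst.tendsto (a, b, t)).mono_left hU1
      have hb : Filter.Tendsto (fun q : X × X × ℝ => q.2.1) U (𝓝 b) :=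
        (continuous_snd.fst.tendsto (a, b, t)).mono_left hU1
      have hT : Filter.Tendsto (fun q : X × X × ℝ => q.2.2) U (𝓝 t) :=
        (continuous_snd.snd.tendsto (a, b, t)).mono_left hU1
      have e1 : dist a V.lim = t * dist a b := tendsto_nhds_unique_of_eventuallyEq (ha.dist hV)
        (hT.mul (ha.dist hb)) (Filter.mem_of_superset hev fun q hq => (hgeo _ _ _ hq.1 hq.2).1)
      have e2 : dist V.lim b = (1 - t) * dist a b := tendsto_nhds_unique_of_eventuallyEq
        (hV.dist hb) ((tendsto_const_nhds.sub hT).mul (ha.dist hb))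
        (Filter.mem_of_superset hev fun q hq => (hgeo _ _ _ hq.1 hq.2).2)
      obtain ⟨e3, e4⟩ := hgeo a b t hab ht
      have : V.lim = geo a b t := h.eq_of_dist hab ht e1 e2 e3 e4
      rwa [this] at hV }

/-- Jung's theorem for tripodal spaces: a finite set is contained in a ball whose radius is half
of its diameter. -/
theorem exists_center (h : IsTripodal X r) {σ : Finset X} (hσ : σ.Nonempty) {β : ℝ} (hβ : β ≤ r)
    (hd : ∀ p ∈ σ, ∀ q ∈ σ, dist p q < β) : ∃ y, ∀ p ∈ σ, dist y p < β / 2 := by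
  obtain ⟨⟨a, b⟩, hab, hmax⟩ := Finset.exists_max_image (σ ×ˢ σ) (fun z => dist z.1 z.2)
    (hσ.product hσ)
  obtain ⟨ha, hb⟩ := Finset.mem_product.1 hab
  have hmax' : ∀ p ∈ σ, ∀ q ∈ σ, dist p q ≤ dist a b := fun p hp q hq =>
    hmax (p, q) (Finset.mem_product.2 ⟨hp, hq⟩)
  have hlt := hd a ha b hb
  -- The centre is the midpoint of a diametral pair: for each `p` it lies between `p` and an end,
  -- and that end is at most `dist a b` from `p`, so half of `dist a b` remains.
  obtain ⟨y, h1, h2⟩ := h.midpoint a b (hlt.trans_le hβ)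
  refine ⟨y, fun p hp => ?_⟩
  rw [dist_comm]
  have e := dist_comm y a
  rcases h.tripod a b p y (hlt.trans_le hβ) ((hd b hb p hp).trans_le hβ)
    ((hd p hp a ha).trans_le hβ) (by linarith) with h3 | h3
  · linarith [hmax' p hp a ha]
  · linarith [hmax' p hp b hb]

end IsTripodal

end TripodSpace

/-! ### Compact length spaces -/

section LengthSpace

variable {G : Type*} [EMetricSpace G]

/-- Three sides below a third of the systole have perimeter below the systole, and truncation at `R`
does not affect sums of distances below `R`. -/
theorem IsLengthMetric.isTripodal [CompactSpace G] (hG : IsLengthMetric G) {R : ℝ} (hR : 0 < R)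
    (hsys : ENNReal.ofReal R < systole G / 3) :
    @IsTripodal G (truncMetric G hR) R := by
  have hadd : ∀ {x y z w u v : G}, truncDist R x y < R → truncDist R z w < R →
      truncDist R u v < R → (truncDist R x y + truncDist R z w = truncDist R u v ↔
        edist x y + edist z w = edist u v) := by
    intro x y z w u v h1 h2 h3
    rw [edist_eq_of_truncDist_lt h1, edist_eq_of_truncDist_lt h2, edist_eq_of_truncDist_lt h3,
      ← ENNReal.ofReal_add (truncDist_nonneg _ _ _) (truncDist_nonneg _ _ _),
      ENNReal.ofReal_eq_ofReal_iff (add_nonneg (truncDist_nonneg _ _ _) (truncDist_nonneg _ _ _))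
        (truncDist_nonneg _ _ _)]
  refine @IsTripodal.mk G (truncMetric G hR) R (fun a b h => hG.truncMetric_midpoint h) ?_
  intro a b p z hab hbp hpa hz
  change truncDist R a b < R at hab
  change truncDist R b p < R at hbp
  change truncDist R p a < R at hpa
  change truncDist R a z + truncDist R z b = truncDist R a b at hz
  change truncDist R p z + truncDist R z a = truncDist R p a ∨
    truncDist R p z + truncDist R z b = truncDist R p b
  have hcomm : ∀ x y : G, truncDist R x y = truncDist R y x := fun x y => by
    simp [truncDist, edist_comm]
  have haz : truncDist R a z < R := by linarith [truncDist_nonneg R z b]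
  have hzb : truncDist R z b < R := by linarith [truncDist_nonneg R a z]
  have hpb : truncDist R p b < R := by rwa [hcomm]
  have hlt : ∀ {x y : G}, truncDist R x y < R → edist x y < systole G / 3 := fun h =>
    ((truncDist_lt_iff le_rfl).1 h).trans hsys
  have hper : edist a b + edist b p + edist p a < systole G := by
    rw [← ENNReal.add_thirds (systole G)]
    exact ENNReal.add_lt_add (ENNReal.add_lt_add (hlt hab) (hlt hbp)) (hlt hpa)
  have hpz : ∀ {x : G}, truncDist R p x < R → edist p z + edist z x = edist p x →
      truncDist R p z < R := fun hx he => by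
    rw [truncDist_lt_iff le_rfl] at hx ⊢
    exact (le_self_add.trans he.le).trans_lt hx
  rcases hG.tripod hper ((hadd haz hzb hab).1 hz) with h | h
  · exact Or.inl ((hadd (hpz hpa h) (by rwa [hcomm]) hpa).2 h)
  · exact Or.inr ((hadd (hpz hpb h) hzb hpb).2 h)

theorem mem_vietorisRips_iff {R β : ℝ} (hβR : β ≤ R) {σ : Finset G} :
    σ ∈ (vietorisRips G β).faces ↔
      σ.Nonempty ∧ ∀ p ∈ σ, ∀ q ∈ σ, truncDist R p q < β := by
  refine and_congr_right fun hσ => ⟨fun h p hp q hq => ?_, fun h => ?_⟩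
  · rw [truncDist_lt_iff hβR]
    exact (Metric.edist_le_ediam_of_mem (Finset.mem_coe.2 hp) (Finset.mem_coe.2 hq)).trans_lt h
  · obtain ⟨⟨a, b⟩, hab, hmax⟩ := Finset.exists_max_image (σ ×ˢ σ) (fun z => edist z.1 z.2)
      (hσ.product hσ)
    obtain ⟨ha, hb⟩ := Finset.mem_product.1 hab
    refine lt_of_le_of_lt (Metric.ediam_le fun p hp q hq => ?_)
      ((truncDist_lt_iff hβR).1 (h a ha b hb))
    exact hmax (p, q) (Finset.mem_product.2 ⟨hp, hq⟩)

theorem IsLengthMetric.vietorisRips_eq_cech [CompactSpace G] (hG : IsLengthMetric G) {β : ℝ}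
    (hβ : 0 < β) (hsys : ENNReal.ofReal β < systole G / 3) :
    vietorisRips G β = cech G (β / 2) := by
  have hfaces : (vietorisRips G β).faces = (cech G (β / 2)).faces := by
    ext σ
    rw [mem_vietorisRips_iff le_rfl]
    refine and_congr_right fun hσ => ⟨fun h => ?_, ?_⟩
    · obtain ⟨y, hy⟩ := @IsTripodal.exists_center G (truncMetric G hβ) β (hG.isTripodal hβ hsys)
        σ hσ β le_rfl h
      exact ⟨y, fun x hx => (truncDist_lt_iff (by linarith : β / 2 ≤ β)).1 (hy x hx)⟩
    · rintro ⟨y, hy⟩ p hp q hq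
      rw [truncDist_lt_iff le_rfl, show β = β / 2 + β / 2 by ring,
        ENNReal.ofReal_add (by linarith) (by linarith)]
      exact (edist_triangle_left p q y).trans_lt (ENNReal.add_lt_add (hy p hp) (hy q hq))
  exact PreAbstractSimplicialComplex.ext hfaces

/-- The order of the quantifiers matters: one `B` serves all scales up to `R`, which makes the
equivalences commute with the inclusions. -/
theorem IsLengthMetric.exists_homotopyEquiv [CompactSpace G] [Nonempty G] (hG : IsLengthMetric G)
    {R : ℝ} (hR : 0 < R) (hsys : ENNReal.ofReal R < systole G / 3) :
    ∃ B : (G → ℝ) → G, ∀ β : ℝ, 0 < β → β ≤ R →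
      ∃ e : ContinuousMap.HomotopyEquiv (Realization (vietorisRips G β)) G,
        ∀ x, e.toFun x = B x.1 := by
  let S := @IsTripodal.shortGeodesics G (truncMetric G hR) R _ (hG.isTripodal hR hsys)
  exact ⟨@ShortGeodesics.bary G (truncMetric G hR) R S _, fun β hβ hβR =>
    @ShortGeodesics.exists_homotopyEquiv G (truncMetric G hR) _ β R S _ hβ hβR
      fun σ => mem_vietorisRips_iff hβR⟩

end LengthSpace

/-! ### Comparison of two scales -/

theorem IsHomotopyEquivalence.of_comp {X Y Z : Type*} [TopologicalSpace X] [TopologicalSpace Y]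
    [TopologicalSpace Z] {i : C(X, Y)} (e : ContinuousMap.HomotopyEquiv X Z)
    (e' : ContinuousMap.HomotopyEquiv Y Z) (h : e'.toFun.comp i = e.toFun) :
    IsHomotopyEquivalence i := by
  refine ⟨⟨i, e.invFun.comp e'.toFun, ?_, ?_⟩, rfl⟩
  · rw [ContinuousMap.comp_assoc, h]
    exact e.left_inv
  · have h1 : (e'.invFun.comp e'.toFun).Homotopic (ContinuousMap.id Y) := e'.left_inv
    have h2 : ((e'.invFun.comp e'.toFun).comp (i.comp (e.invFun.comp e'.toFun))).Homotopic
        (i.comp (e.invFun.comp e'.toFun)) :=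
      h1.comp (ContinuousMap.Homotopic.refl _)
    have h3 : (e'.invFun.comp e'.toFun).comp (i.comp (e.invFun.comp e'.toFun)) =
        (e'.invFun.comp (e.toFun.comp e.invFun)).comp e'.toFun := by
      rw [← h]; rfl
    rw [h3] at h2
    have h4 : ((e'.invFun.comp (e.toFun.comp e.invFun)).comp e'.toFun).Homotopic
        (e'.invFun.comp e'.toFun) :=
      ((ContinuousMap.Homotopic.refl e'.invFun).comp e.right_inv).comp
        (ContinuousMap.Homotopic.refl e'.toFun)
    exact h2.symm.trans (h4.trans h1)

instance Realization.instIsEmpty {ι : Type*} [IsEmpty ι] (K : PreAbstractSimplicialComplex ι) :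
    IsEmpty (Realization K) :=
  ⟨fun x => isEmptyElim x.carrier_nonempty.choose⟩

end MetricGraph

end

theorem mainTheorem4 (G : Type*) [EMetricSpace G] [CompactSpace G]
    (hG : MetricGraph.IsMetricGraph G) :
    (∀ β : ℝ, 0 < β → ENNReal.ofReal β < MetricGraph.systole G / 3 →
      MetricGraph.vietorisRips G β = MetricGraph.cech G (β / 2) ∧
      Nonempty (ContinuousMap.HomotopyEquiv
        (MetricGraph.Realization (MetricGraph.vietorisRips G β)) G)) ∧
    (∀ (β β' : ℝ) (_ : 0 < β) (hle : β ≤ β'), ENNReal.ofReal β' < MetricGraph.systole G / 3 →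
      MetricGraph.IsHomotopyEquivalence
        (MetricGraph.Realization.inclusion (MetricGraph.vietorisRips_mono G hle))) := by
  refine ⟨fun β hβ hsys => ⟨hG.1.vietorisRips_eq_cech hβ hsys, ?_⟩, fun β β' hβ hle hsys => ?_⟩
  -- The barycenter has a default value and so needs a point; over the empty space the realization
  -- is empty too.
  · rcases isEmpty_or_nonempty G with hE | hN
    · exact ⟨(Homeomorph.empty).toHomotopyEquiv⟩
    · obtain ⟨B, hB⟩ := hG.1.exists_homotopyEquiv hβ hsys
      exact ⟨(hB β hβ le_rfl).choose⟩
  · rcases isEmpty_or_nonempty G with hE | hN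
    · exact ⟨(Homeomorph.empty).toHomotopyEquiv, ContinuousMap.ext fun x => isEmptyElim x⟩
    · obtain ⟨B, hB⟩ := hG.1.exists_homotopyEquiv (hβ.trans_le hle) hsys
      obtain ⟨e, he⟩ := hB β hβ hle
      obtain ⟨e', he'⟩ := hB β' (hβ.trans_le hle) le_rfl
      exact MetricGraph.IsHomotopyEquivalence.of_comp e e'
        (ContinuousMap.ext fun x => (he' _).trans (he x).symm)
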